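/- Let $K=\mathbb{Q}(\sqrt D)$ be an imaginary-quadratic field, with $D<0$ a square-free integer; let $\mathfrak o$ be its ring of integers, $d_K$ its discriminant, $\alpha\mapsto\overline{\alpha}$ its non-trivial automorphism and $\mathcal C_K$ its ideal class group. A hermitian space over $K$ is a finite-dimensional $K$-vector space $V$ with a form $h:V\times V\to K$ that is linear in the first variable, semilinear in the second, and satisfies $h(x,y)=\overline{h(y,x)}$. A lattice on $V$ is a finitely generated $\mathfrak o$-submodule $L\subseteq V$ with $K\cdot L=V$; its rank is $\dim_K V$, and it is definite if $h(x,x)>0$ for all $x\in V\setminus\{0\}$. Write $L=\mathfrak a_1x_1+\dots+\mathfrak a_nx_n$ with a basis $x_1,\dots,x_n$ of $V$ and fractional ideals $\mathfrak a_i\neq 0$ of $K$. The Steinitz class of $L$ is the class of $\prod_i\mathfrak a_i$ in $\mathcal C_K$, and the volume of $L$ is the fractional ideal $\prod_i\mathfrak a_i\overline{\mathfrak a_i}\cdot\det(h(x_i,x_j))_{i,j}$; neither depends on the chosen decomposition. The lattice $L$ is unimodular if its volume is $\mathfrak o$ and the $\mathfrak o$-module generated by all $h(x,y)$, $x,y\in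 L$, is $\mathfrak o$. It is even if $h(x,x)\in 2\mathfrak o$ for all $x\in L$, and odd otherwise. For a prime $p$ and $\alpha\in\mathbb{Q}_p^*$, let $(\alpha,K/\mathbb{Q})_p$ be $+1$ if $\alpha$ is the norm of a unit of $K_p=K\otimes_{\mathbb Q}\mathbb{Q}_p$, and $-1$ otherwise. Let $\mathfrak a$ be a nonzero fractional ideal of $K$, with class $[\mathfrak a]\in\mathcal C_K$ and norm $N(\mathfrak a)$, and let $n\ge 1$ be an integer. a) There is a definite odd unimodular lattice of rank $n$ over $K$ with Steinitz class $[\mathfrak a]$. b) There is a definite even unimodular lattice of rank $n$ over $K$ with Steinitz class $[\mathfrak a]$ if and only if the following three conditions hold: (i) $d_K$ is even; (ii) $n$ is even; (iii) if $D\equiv 3 \pmod 4$, then $(N(\mathfrak a),K/\mathbb{Q})_2=(-1)^{n/2}$. -/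

import Mathlib

open NumberField Module
open scoped nonZeroDivisors TensorProduct

universe u

/-- A hermitian space over `K`: a finite-dimensional `K`-vector space with a form that is linear in
the first and `σ`-semilinear in the second variable and satisfies `h(x,y) = σ(h(y,x))`; here `σ` is
the conjugation of `K`. The `𝓞 K`-module structure is the restriction of the `K`-module structure,
as the scalar tower condition says. -/
structure HermitianSpace (K : Type u) [Field K] [NumberField K] (σ : K ≃ₐ[ℚ] K) where
  carrier : Type u
  [addCommGroup : AddCommGroup carrier]
  [module : Module K carrier]
  [finite : Module.Finite K carrier]
  [moduleInt : Module (𝓞 K) carrier]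
  [tower : IsScalarTower (𝓞 K) K carrier]
  form : carrier →ₗ[K] carrier →ₛₗ[(σ : K →+* K)] K
  form_conj : ∀ x y, form x y = σ (form y x)

attribute [instance] HermitianSpace.addCommGroup HermitianSpace.module HermitianSpace.finite
  HermitianSpace.moduleInt HermitianSpace.tower

/-- A hermitian lattice in `V`: a finitely generated `𝓞 K`-submodule of `V`. -/
structure HermitianLattice {K : Type u} [Field K] [NumberField K] {σ : K ≃ₐ[ℚ] K}
    (V : HermitianSpace K σ) where
  toSubmodule : Submodule (𝓞 K) V.carrier
  fg : toSubmodule.FG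

namespace HermitianLattice

variable {K : Type u} [Field K] [NumberField K] {σ : K ≃ₐ[ℚ] K} {V : HermitianSpace K σ}

/-- The subspace `K·L` of `V`. -/
def spanField (L : HermitianLattice V) : Submodule K V.carrier :=
  Submodule.span K (L.toSubmodule : Set V.carrier)

/-- The rank of `L`, i.e. the dimension of `K·L`. -/
noncomputable def rank (L : HermitianLattice V) : ℕ := finrank K L.spanField

/-- `L` is a lattice on `V`, i.e. `K·L = V`. -/
def IsOn (L : HermitianLattice V) : Prop := L.spanField = ⊤

/-- `L` is (positive) definite: `h(x,x)` is a positive rational number for all nonzero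
`x ∈ K·L`. -/
def IsDefinite (L : HermitianLattice V) : Prop :=
  ∀ x ∈ L.spanField, x ≠ 0 → ∃ q : ℚ, 0 < q ∧ V.form x x = algebraMap ℚ K q

/-- The scale of `L`: the `𝓞 K`-submodule of `K` generated by all `h(x,y)` with `x, y ∈ L`. -/
def scale (L : HermitianLattice V) : Submodule (𝓞 K) K :=
  Submodule.span (𝓞 K) {a | ∃ x ∈ L.toSubmodule, ∃ y ∈ L.toSubmodule, V.form x y = a}

/-- The norm of `L`: the `𝓞 K`-submodule of `K` generated by all `h(x,x)` with `x ∈ L`. -/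
def normIdeal (L : HermitianLattice V) : Submodule (𝓞 K) K :=
  Submodule.span (𝓞 K) {a | ∃ x ∈ L.toSubmodule, V.form x x = a}

/-- `L` is even if its norm is contained in `2·𝓞 K`. -/
def IsEven (L : HermitianLattice V) : Prop :=
  L.normIdeal ≤ Submodule.span (𝓞 K) {(2 : K)}

/-- `L` is odd if it is not even. -/
def IsOdd (L : HermitianLattice V) : Prop := ¬ L.IsEven

/-- A decomposition `L = 𝔞₁x₁ + ⋯ + 𝔞ₙxₙ` with a basis `x₁, …, xₙ` of `V` and nonzero fractional
ideals `𝔞₁, …, 𝔞ₙ` of `K`: the elements of `L` are the vectors whose `i`-th coordinate lies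
in `𝔞ᵢ`, for every `i`. Every lattice on `V` has such a decomposition. -/
structure PseudoBasis (L : HermitianLattice V) (n : ℕ) where
  basis : Basis (Fin n) K V.carrier
  ideal : Fin n → (FractionalIdeal (𝓞 K)⁰ K)ˣ
  mem_iff : ∀ v : V.carrier, v ∈ L.toSubmodule ↔
    ∀ i, basis.repr v i ∈ (ideal i : FractionalIdeal (𝓞 K)⁰ K)

/-- The product `∏ 𝔞ᵢ · σ(𝔞ᵢ) · det(h(xᵢ,xⱼ))`, as an `𝓞 K`-submodule of `K`. -/
noncomputable def PseudoBasis.volume {L : HermitianLattice V} {n : ℕ} (P : L.PseudoBasis n) :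
    Submodule (𝓞 K) K :=
  (∏ i, ((P.ideal i : FractionalIdeal (𝓞 K)⁰ K) : Submodule (𝓞 K) K) *
      Submodule.span (𝓞 K) (σ '' {a : K | a ∈ (P.ideal i : FractionalIdeal (𝓞 K)⁰ K)})) *
    Submodule.span (𝓞 K) {(Matrix.of fun i j => V.form (P.basis i) (P.basis j)).det}

/-- `L` has volume `𝔳`; the volume does not depend on the decomposition. -/
def HasVolume (L : HermitianLattice V) (𝔳 : Submodule (𝓞 K) K) : Prop :=
  ∃ (n : ℕ) (P : L.PseudoBasis n), P.volume = 𝔳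

/-- The Steinitz class of `L` is `c`, i.e. `c` is the class of `∏ 𝔞ᵢ` for a decomposition
`L = 𝔞₁x₁ + ⋯ + 𝔞ₙxₙ`; the class does not depend on the decomposition. -/
def HasSteinitzClass (L : HermitianLattice V) (c : ClassGroup (𝓞 K)) : Prop :=
  ∃ (n : ℕ) (P : L.PseudoBasis n), ClassGroup.mk K (∏ i, P.ideal i) = c

/-- `L` is a unimodular lattice on `V`: its scale and its volume are both `𝓞 K`. -/
def IsUnimodular (L : HermitianLattice V) : Prop :=
  L.IsOn ∧ L.scale = 1 ∧ L.HasVolume 1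

end HermitianLattice

open Classical in
/-- The local norm residue symbol `(α, K/ℚ)_p` of a nonzero `α ∈ ℚ_p`: it is `1` if `α` is the norm
of a unit of `K_p = ℚ_p ⊗ K`, and `-1` otherwise. -/
noncomputable def normResidueSymbol (K : Type u) [Field K] [NumberField K] (p : ℕ)
    [Fact p.Prime] (α : ℚ_[p]) : ℤ :=
  if ∃ x : (ℚ_[p] ⊗[ℚ] K)ˣ, Algebra.norm ℚ_[p] (x : ℚ_[p] ⊗[ℚ] K) = α then 1 else -1

/-!
Since `𝔞 σ(𝔞) = (N(𝔞))`, the ideal `𝔞` with the form `x σ(y) / N(𝔞)` is a definite odd unimodular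
lattice of rank one, and `⟨1⟩ ⊥ ⋯ ⊥ ⟨1⟩ ⊥ 𝔞` settles the odd case. Moreover every nonzero `𝔞`
contains some `t` with `N(t) = m N(𝔞)` and `m` odd.

Let `L = 𝔞₁x₁ + ⋯ + 𝔞ₙxₙ` be even unimodular. As
`h(x,y) + σ(h(x,y)) = h(x+y,x+y) - h(x,x) - h(y,y)` and the scale of `L` is `𝔬`, all traces from
`𝔬` are even, so `D ≢ 1 (mod 4)` and `𝔬 = ℤ[√D]`. For `tᵢ ∈ 𝔞ᵢ` as above, the vectors `tᵢxᵢ` have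
an even hermitian Gram matrix over `ℤ[√D]` of odd determinant `m = ∏ mᵢ`. Splitting off binary
blocks shows that `n` is even and, if `D ≡ 3 (mod 4)`, that `m ≡ (-1)^(n/2) (mod 4)`; up to norms
`m` is `N(∏ 𝔞ᵢ)`, and on odd integers the symbol at `2` is the quadratic character modulo `4`.

Conversely, pick such a `t ∈ 𝔞`. If `4 ∣ n - 1 + m`, then `h(v,v) ∈ 4ℤ` for `v = (1,…,1,t)`, and
the neighbour of `⟨1⟩ ⊥ ⋯ ⊥ ⟨1⟩ ⊥ 𝔞` along `v` at the prime above `2` is even. If `D ≡ 3 (mod 4)`,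
the condition on the symbol is exactly this congruence; otherwise one may replace `t` by
`(1 + √D) t`, which changes the sign of `m` modulo `4`.
-/

open scoped Matrix

/-- `K = ℚ(δ)` with `δ² = D` a negative square-free integer, and `σ` is its conjugation. -/
structure IsImaginaryQuadratic {K : Type u} [Field K] [NumberField K] (D : ℤ) (δ : K)
    (σ : K ≃ₐ[ℚ] K) : Prop where
  neg : D < 0
  squarefree : Squarefree D
  sq : δ ^ 2 = (D : K)
  exists_repr : ∀ x : K, ∃ a b : ℚ, x = a + b * δ
  conj : σ δ = -δ

section BasisOneSqrt

variable {R A : Type*} [CommRing R] [CommRing A] [Algebra R A]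

theorem leftMulMatrix_of_basis_one_sqrt (b : Basis (Fin 2) R A) (h0 : b 0 = 1) {d : R}
    (h1 : b 1 ^ 2 = algebraMap R A d) (x y : R) :
    Algebra.leftMulMatrix b (x • b 0 + y • b 1) = !![x, d * y; y, x] := by
  have e0 : (x • b 0 + y • b 1) * b 0 = x • b 0 + y • b 1 := by rw [h0, mul_one]
  have e1 : (x • b 0 + y • b 1) * b 1 = (d * y) • b 0 + x • b 1 := by
    rw [add_mul, smul_mul_assoc, smul_mul_assoc, ← sq, h1, h0, one_mul, add_comm,
      Algebra.algebraMap_eq_smul_one, smul_smul, mul_comm y d]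
  ext i j
  rw [Algebra.leftMulMatrix_eq_repr_mul]
  fin_cases i <;> fin_cases j <;> simp [e0, e1]

theorem norm_of_basis_one_sqrt (b : Basis (Fin 2) R A) (h0 : b 0 = 1) {d : R}
    (h1 : b 1 ^ 2 = algebraMap R A d) (x y : R) :
    Algebra.norm R (x • b 0 + y • b 1) = x ^ 2 - d * y ^ 2 := by
  rw [Algebra.norm_eq_matrix_det b, leftMulMatrix_of_basis_one_sqrt b h0 h1, Matrix.det_fin_two_of]
  ring

theorem trace_of_basis_one_sqrt (b : Basis (Fin 2) R A) (h0 : b 0 = 1) {d : R}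
    (h1 : b 1 ^ 2 = algebraMap R A d) (x y : R) :
    Algebra.trace R A (x • b 0 + y • b 1) = 2 * x := by
  rw [Algebra.trace_eq_matrix_trace b, leftMulMatrix_of_basis_one_sqrt b h0 h1,
    Matrix.trace_fin_two_of, two_mul]

end BasisOneSqrt

section Discriminant

variable {R A ι : Type*} [CommRing R] [CommRing A] [Algebra R A] [Fintype ι] [DecidableEq ι]

theorem discr_basis_dvd_discr (b : Basis ι R A) (v : ι → A) :
    Algebra.discr R b ∣ Algebra.discr R v := by
  have hv : Matrix.vecMul b ((b.toMatrix v).map (algebraMap R A)) = v := by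
    ext1 i
    simp only [Matrix.vecMul, dotProduct, Matrix.map_apply, mul_comm (b _), ← Algebra.smul_def]
    exact b.sum_toMatrix_smul_self v i
  rw [← hv, Algebra.discr_of_matrix_vecMul]
  exact dvd_mul_left _ _

theorem dvd_discr_of_forall_dvd_trace [Nonempty ι] {r : R}
    (hr : ∀ x : A, r ∣ Algebra.trace R A x) (v : ι → A) : r ∣ Algebra.discr R v := by
  rw [Algebra.discr_def, Matrix.det_apply]
  refine Finset.dvd_sum fun τ _ => dvd_smul_of_dvd _ ?_
  obtain ⟨i⟩ := ‹Nonempty ι›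
  exact (hr _).trans (Finset.dvd_prod_of_mem _ (Finset.mem_univ i))

end Discriminant

section Squarefree

theorem exists_intCast_of_mul_sq {D : ℤ} (hD : Squarefree D) {b : ℚ} {m : ℤ}
    (h : (D : ℚ) * b ^ 2 = m) : ∃ c : ℤ, b = c := by
  have h2 : D * b.num ^ 2 = m * (b.den : ℤ) ^ 2 := by
    have hb : (b.den : ℚ) ≠ 0 := by exact_mod_cast b.den_nz
    have h3 : (D : ℚ) * (b.num : ℚ) ^ 2 = m * (b.den : ℚ) ^ 2 := by
      rw [← h]
      nth_rewrite 2 [← Rat.num_div_den b]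
      field_simp
    exact_mod_cast h3
  have hcop : IsCoprime ((b.den : ℤ) ^ 2) (b.num ^ 2) :=
    (Int.isCoprime_iff_gcd_eq_one.2 (by rw [Int.gcd_comm]; exact b.reduced)).pow
  have hunit : IsUnit (b.den : ℤ) :=
    hD _ (by rw [← pow_two]; exact hcop.dvd_of_dvd_mul_right (Dvd.intro_left _ h2.symm))
  have hden : b.den = 1 := by simpa [Int.isUnit_iff_natAbs_eq] using hunit
  exact ⟨b.num, (Rat.coe_int_num_of_den_eq_one hden).symm⟩

theorem emod_four_ne_zero_of_squarefree {D : ℤ} (hD : Squarefree D) : D % 4 ≠ 0 := fun h => by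
  have := hD 2 (Int.dvd_of_emod_eq_zero h)
  rw [Int.isUnit_iff] at this
  omega

theorem even_and_even_of_four_dvd_sq_sub {D a b : ℤ} (hD : D % 4 = 2 ∨ D % 4 = 3)
    (h : 4 ∣ a ^ 2 - D * b ^ 2) : Even a ∧ Even b := by
  have key : ∀ d x y : ZMod 4, d = 2 ∨ d = 3 → x ^ 2 - d * y ^ 2 = 0 → 2 * x = 0 ∧ 2 * y = 0 := by
    decide
  have hD4 : (D : ZMod 4) = 2 ∨ (D : ZMod 4) = 3 :=
    hD.imp (fun h => (ZMod.intCast_eq_intCast_iff D 2 4).2 h)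
      fun h => (ZMod.intCast_eq_intCast_iff D 3 4).2 h
  obtain ⟨ha, hb⟩ := key D a b hD4 (by exact_mod_cast (ZMod.intCast_zmod_eq_zero_iff_dvd _ 4).2 h)
  have ha' := (ZMod.intCast_zmod_eq_zero_iff_dvd (2 * a) 4).1 (by exact_mod_cast ha)
  have hb' := (ZMod.intCast_zmod_eq_zero_iff_dvd (2 * b) 4).1 (by exact_mod_cast hb)
  rw [Int.even_iff, Int.even_iff]
  omega

end Squarefree

theorem exists_intCast_of_isIntegral_ratCast {K : Type*} [Field K] [CharZero K] {q : ℚ}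
    (hq : IsIntegral ℤ (q : K)) : ∃ m : ℤ, q = m := by
  rw [← eq_ratCast (algebraMap ℚ K), isIntegral_algebraMap_iff (algebraMap ℚ K).injective] at hq
  obtain ⟨m, hm⟩ := IsIntegrallyClosed.isIntegral_iff.1 hq
  exact ⟨m, by simpa using hm.symm⟩

namespace IsImaginaryQuadratic

variable {K : Type u} [Field K] [NumberField K] {D : ℤ} {δ : K} {σ : K ≃ₐ[ℚ] K}

theorem exists_repr_of_adjoin_eq_top (hδ : δ ^ 2 = (D : K))
    (hK : IntermediateField.adjoin ℚ {δ} = ⊤) (x : K) : ∃ a b : ℚ, x = a + b * δ := by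
  have hx : x ∈ Algebra.adjoin ℚ {δ} := by
    rw [← IntermediateField.adjoin_simple_toSubalgebra_of_isAlgebraic
      (Algebra.IsAlgebraic.isAlgebraic δ), hK]
    trivial
  induction hx using Algebra.adjoin_induction with
  | mem x hx => exact ⟨0, 1, by simp [Set.mem_singleton_iff.1 hx]⟩
  | algebraMap r => exact ⟨r, 0, by simp⟩
  | add x y _ _ hx hy =>
    obtain ⟨a, b, rfl⟩ := hx
    obtain ⟨c, d, rfl⟩ := hy
    exact ⟨a + c, b + d, by push_cast; ring⟩
  | mul x y _ _ hx hy =>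
    obtain ⟨a, b, rfl⟩ := hx
    obtain ⟨c, d, rfl⟩ := hy
    refine ⟨a * c + D * b * d, a * d + b * c, ?_⟩
    push_cast
    linear_combination b * d * hδ

theorem of_adjoin (hD : D < 0) (hsq : Squarefree D) (hδ : δ ^ 2 = (D : K))
    (hK : IntermediateField.adjoin ℚ {δ} = ⊤) (hσ : σ ≠ AlgEquiv.refl) :
    IsImaginaryQuadratic D δ σ := by
  have hrep := exists_repr_of_adjoin_eq_top hδ hK
  refine ⟨hD, hsq, hδ, hrep, ?_⟩
  have h1 : σ δ ^ 2 = δ ^ 2 := by rw [← map_pow, hδ, map_intCast]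
  refine (sq_eq_sq_iff_eq_or_eq_neg.1 h1).resolve_left fun h => hσ ?_
  ext x
  obtain ⟨a, b, rfl⟩ := hrep x
  simp [h]

theorem ne_ratCast (h : IsImaginaryQuadratic D δ σ) (q : ℚ) : δ ≠ (q : K) := by
  rintro rfl
  have hq : q ^ 2 = (D : ℚ) := by exact_mod_cast h.sq
  have hD : (D : ℚ) < 0 := by exact_mod_cast h.neg
  exact hD.not_ge (hq ▸ sq_nonneg q)

theorem linearIndependent (h : IsImaginaryQuadratic D δ σ) :
    LinearIndependent ℚ ![(1 : K), δ] := by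
  rw [LinearIndependent.pair_iff' one_ne_zero]
  intro a ha
  exact h.ne_ratCast a (by simpa [Algebra.smul_def] using ha.symm)

/-- The basis `1, δ` of `K` over `ℚ`. -/
noncomputable def basis (h : IsImaginaryQuadratic D δ σ) : Basis (Fin 2) ℚ K :=
  Basis.mk h.linearIndependent fun x _ => by
    obtain ⟨a, b, rfl⟩ := h.exists_repr x
    refine Submodule.mem_span_range_iff_exists_fun ℚ |>.2 ⟨![a, b], ?_⟩
    simp [Fin.sum_univ_two, Algebra.smul_def]

@[simp] theorem basis_zero (h : IsImaginaryQuadratic D δ σ) : h.basis 0 = 1 := by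
  simp [basis]

@[simp] theorem basis_one (h : IsImaginaryQuadratic D δ σ) : h.basis 1 = δ := by
  simp [basis]

theorem finrank_eq_two (h : IsImaginaryQuadratic D δ σ) : finrank ℚ K = 2 := by
  simpa using finrank_eq_card_basis h.basis

theorem norm_add_mul (h : IsImaginaryQuadratic D δ σ) (a b : ℚ) :
    Algebra.norm ℚ ((a : K) + b * δ) = a ^ 2 - D * b ^ 2 := by
  simpa [Algebra.smul_def] using
    norm_of_basis_one_sqrt h.basis h.basis_zero (d := (D : ℚ)) (by simpa using h.sq) a b

theorem trace_add_mul (h : IsImaginaryQuadratic D δ σ) (a b : ℚ) :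
    Algebra.trace ℚ K ((a : K) + b * δ) = 2 * a := by
  simpa [Algebra.smul_def] using
    trace_of_basis_one_sqrt h.basis h.basis_zero (d := (D : ℚ)) (by simpa using h.sq) a b

theorem conj_add_mul (h : IsImaginaryQuadratic D δ σ) (a b : ℚ) :
    σ ((a : K) + b * δ) = a - b * δ := by
  simp [h.conj, sub_eq_add_neg]

@[simp] theorem conj_conj (h : IsImaginaryQuadratic D δ σ) (x : K) : σ (σ x) = x := by
  obtain ⟨a, b, rfl⟩ := h.exists_repr x
  simp [h.conj]

theorem mul_conj (h : IsImaginaryQuadratic D δ σ) (x : K) :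
    x * σ x = (Algebra.norm ℚ x : ℚ) := by
  obtain ⟨a, b, rfl⟩ := h.exists_repr x
  rw [h.norm_add_mul, h.conj_add_mul]
  push_cast
  linear_combination - b ^ 2 * h.sq

theorem add_conj (h : IsImaginaryQuadratic D δ σ) (x : K) :
    x + σ x = (Algebra.trace ℚ K x : ℚ) := by
  obtain ⟨a, b, rfl⟩ := h.exists_repr x
  rw [h.trace_add_mul, h.conj_add_mul]
  push_cast
  ring

theorem norm_pos (h : IsImaginaryQuadratic D δ σ) {x : K} (hx : x ≠ 0) :
    0 < Algebra.norm ℚ x := by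
  refine lt_of_le_of_ne ?_ (Algebra.norm_ne_zero_iff.2 hx).symm
  obtain ⟨a, b, rfl⟩ := h.exists_repr x
  have hD : (D : ℚ) < 0 := by exact_mod_cast h.neg
  rw [h.norm_add_mul]
  nlinarith [sq_nonneg a, sq_nonneg b]

theorem exists_ratCast_of_conj_eq (h : IsImaginaryQuadratic D δ σ) {x : K} (hx : σ x = x) :
    ∃ q : ℚ, x = q := by
  obtain ⟨a, b, rfl⟩ := h.exists_repr x
  rw [h.conj_add_mul] at hx
  exact ⟨a, by linear_combination (-1 / 2 : K) * hx⟩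

theorem emod_four (h : IsImaginaryQuadratic D δ σ) (hD : ¬ D ≡ 1 [ZMOD 4]) :
    D % 4 = 2 ∨ D % 4 = 3 := by
  have := emod_four_ne_zero_of_squarefree h.squarefree
  rw [Int.ModEq] at hD
  omega

theorem exists_half_int_repr (h : IsImaginaryQuadratic D δ σ) {x : K} (hx : IsIntegral ℤ x) :
    ∃ A B : ℤ, 4 ∣ A ^ 2 - D * B ^ 2 ∧ 2 * x = A + B * δ := by
  obtain ⟨a, b, rfl⟩ := h.exists_repr x
  have hσ : IsIntegral ℤ (σ ((a : K) + b * δ)) := hx.map (σ.restrictScalars ℤ)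
  obtain ⟨A, hA⟩ : ∃ A : ℤ, 2 * a = A := by
    refine exists_intCast_of_isIntegral_ratCast (K := K) ?_
    rw [← h.trace_add_mul, ← h.add_conj]
    exact hx.add hσ
  obtain ⟨N, hN⟩ : ∃ N : ℤ, a ^ 2 - D * b ^ 2 = N := by
    refine exists_intCast_of_isIntegral_ratCast (K := K) ?_
    rw [← h.norm_add_mul, ← h.mul_conj]
    exact hx.mul hσ
  obtain ⟨B, hB⟩ : ∃ B : ℤ, 2 * b = B :=
    exists_intCast_of_mul_sq h.squarefree (m := A ^ 2 - 4 * N) (by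
      push_cast; rw [← hA, ← hN]; ring)
  have hAB : (A : ℚ) ^ 2 - D * (B : ℚ) ^ 2 = 4 * N := by rw [← hA, ← hN, ← hB]; ring
  refine ⟨A, B, ⟨N, by exact_mod_cast hAB⟩, ?_⟩
  rw [← Rat.cast_intCast A, ← Rat.cast_intCast B, ← hA, ← hB]
  push_cast
  ring

theorem exists_int_repr (h : IsImaginaryQuadratic D δ σ) (hD : ¬ D ≡ 1 [ZMOD 4]) {x : K}
    (hx : IsIntegral ℤ x) : ∃ a b : ℤ, x = a + b * δ := by
  obtain ⟨A, B, hAB, hx2⟩ := h.exists_half_int_repr hx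
  obtain ⟨⟨a, rfl⟩, ⟨b, rfl⟩⟩ := even_and_even_of_four_dvd_sq_sub (h.emod_four hD) hAB
  refine ⟨a, b, mul_left_cancel₀ (two_ne_zero (α := K)) (hx2.trans ?_)⟩
  push_cast
  ring

theorem isIntegral_sqrt (h : IsImaginaryQuadratic D δ σ) : IsIntegral ℤ δ :=
  IsIntegral.of_pow (n := 2) two_pos (h.sq ▸ isIntegral_algebraMap (R := ℤ) (x := D))

theorem isIntegral_one_add_div_two (h : IsImaginaryQuadratic D δ σ) (hD : D ≡ 1 [ZMOD 4]) :
    IsIntegral ℤ ((1 + δ) / 2) := by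
  obtain ⟨k, hk⟩ := Int.modEq_iff_dvd.1 hD.symm
  have hk' : (D : K) - 1 = 4 * k := by exact_mod_cast congrArg (Int.cast (R := K)) hk
  refine ⟨Polynomial.X ^ 2 - Polynomial.X - Polynomial.C k, by monicity!, ?_⟩
  simp only [Polynomial.eval₂_sub, Polynomial.eval₂_pow, Polynomial.eval₂_X, Polynomial.eval₂_C]
  rw [eq_intCast]
  linear_combination (h.sq + hk') / 4

theorem even_trace (h : IsImaginaryQuadratic D δ σ) (hD : ¬ D ≡ 1 [ZMOD 4]) (x : 𝓞 K) :
    2 ∣ Algebra.trace ℤ (𝓞 K) x := by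
  obtain ⟨a, b, (hx : (x : K) = a + b * δ)⟩ := h.exists_int_repr hD x.isIntegral_coe
  refine ⟨a, ?_⟩
  have : ((Algebra.trace ℤ (𝓞 K) x : ℤ) : ℚ) = 2 * a := by
    rw [Algebra.coe_trace_int, hx]
    exact_mod_cast h.trace_add_mul a b
  exact_mod_cast this

theorem discr_one_add_div_two (h : IsImaginaryQuadratic D δ σ) {ω : 𝓞 K}
    (hω : (ω : K) = (1 + δ) / 2) : Algebra.discr ℤ ![1, ω] = D := by
  have tr (x : 𝓞 K) : ((Algebra.trace ℤ (𝓞 K) x : ℤ) : K) = x + σ x := by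
    rw [h.add_conj, ← Algebra.coe_trace_int, Rat.cast_intCast]
  have : ((Algebra.discr ℤ ![1, ω] : ℤ) : K) = D := by
    simp only [Algebra.discr_def, Matrix.det_fin_two, Algebra.traceMatrix_apply,
      Algebra.traceForm_apply, Int.cast_sub, Int.cast_mul, tr, map_mul, Matrix.cons_val_zero,
      Matrix.cons_val_one, map_one, hω, map_div₀, map_add, h.conj, map_ofNat]
    linear_combination h.sq
  exact_mod_cast this

theorem even_discr_iff (h : IsImaginaryQuadratic D δ σ) :
    Even (NumberField.discr K) ↔ ¬ D ≡ 1 [ZMOD 4] := by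
  let B : Basis (Fin 2) ℤ (𝓞 K) :=
    finBasisOfFinrankEq ℤ (𝓞 K) (by rw [RingOfIntegers.rank, h.finrank_eq_two])
  rw [even_iff_two_dvd, ← NumberField.discr_eq_discr K B]
  refine ⟨fun hdiscr hD => ?_, fun hD => dvd_discr_of_forall_dvd_trace (h.even_trace hD) B⟩
  obtain ⟨ω, hω⟩ : ∃ ω : 𝓞 K, (ω : K) = (1 + δ) / 2 :=
    ⟨⟨_, h.isIntegral_one_add_div_two hD⟩, rfl⟩
  have hdvd := hdiscr.trans (discr_basis_dvd_discr B ![1, ω])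
  rw [h.discr_one_add_div_two hω] at hdvd
  rw [Int.ModEq] at hD
  omega

theorem exists_even_intCast_of_mem_span_two (h : IsImaginaryQuadratic D δ σ) {x : K}
    (hx : x ∈ Submodule.span (𝓞 K) {(2 : K)}) (hσ : σ x = x) : ∃ c : ℤ, x = ((2 * c : ℤ) : K) := by
  obtain ⟨c, rfl⟩ := Submodule.mem_span_singleton.1 hx
  obtain ⟨q, hq⟩ := h.exists_ratCast_of_conj_eq hσ
  rw [Algebra.smul_def] at hq ⊢
  have hc : algebraMap (𝓞 K) K c = ((q / 2 : ℚ) : K) := by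
    push_cast
    rw [← hq, mul_div_cancel_right₀ _ two_ne_zero]
  obtain ⟨m, hm⟩ := exists_intCast_of_isIntegral_ratCast (hc ▸ c.isIntegral_coe)
  refine ⟨m, ?_⟩
  rw [hc, hm]
  push_cast
  ring

end IsImaginaryQuadratic

theorem exists_intCast_of_ratCast_mem_one {K : Type*} [Field K] [NumberField K] {q : ℚ}
    (hq : (q : K) ∈ (1 : Submodule (𝓞 K) K)) : ∃ m : ℤ, q = m := by
  obtain ⟨c, hc⟩ := Submodule.mem_one.1 hq
  exact exists_intCast_of_isIntegral_ratCast (hc ▸ c.isIntegral_coe)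

theorem eq_one_of_span_ratCast_eq_one {K : Type*} [Field K] [NumberField K] {r : ℚ} (hr : 0 < r)
    (h : Submodule.span (𝓞 K) {(r : K)} = 1) : r = 1 := by
  obtain ⟨a, ha⟩ := exists_intCast_of_ratCast_mem_one (K := K)
    (h ▸ Submodule.mem_span_singleton_self _)
  obtain ⟨c, hc⟩ := Submodule.mem_span_singleton.1 (h ▸ Submodule.one_le.1 le_rfl :
    (1 : K) ∈ Submodule.span (𝓞 K) {(r : K)})
  have hr' : (r⁻¹ : ℚ) = algebraMap (𝓞 K) K c := by
    rw [Rat.cast_inv, inv_eq_of_mul_eq_one_left (by rw [← hc, Algebra.smul_def])]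
  obtain ⟨b, hb⟩ := exists_intCast_of_ratCast_mem_one (K := K)
    (Submodule.mem_one.2 ⟨c, hr'.symm⟩)
  have hab : a * b = 1 := by
    have : (a : ℚ) * b = 1 := by rw [← ha, ← hb, mul_inv_cancel₀ hr.ne']
    exact_mod_cast this
  have ha0 : 0 < a := by exact_mod_cast ha ▸ hr
  rw [ha, (Int.eq_one_or_neg_one_of_mul_eq_one hab).resolve_right (by omega), Int.cast_one]

section AbsNorm

variable {K : Type u} [Field K] [NumberField K]

theorem absNorm_mem_span_norm_of_ideal (I : Ideal (𝓞 K)) :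
    (Ideal.absNorm I : ℤ) ∈ Submodule.span ℤ (Algebra.norm ℤ '' (I : Set (𝓞 K))) := by
  have hmem : (Ideal.absNorm I : ℤ) ∈ Ideal.relNorm ℤ I := by
    rw [Ideal.relNorm_int]
    exact Ideal.mem_span_singleton_self _
  simpa [Ideal.relNorm_apply, Algebra.intNorm_eq_norm] using hmem

theorem absNorm_unit_pos (I : (FractionalIdeal (𝓞 K)⁰ K)ˣ) :
    0 < FractionalIdeal.absNorm (I : FractionalIdeal (𝓞 K)⁰ K) :=
  lt_of_le_of_ne (FractionalIdeal.absNorm_nonneg _)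
    (Ne.symm fun h => I.ne_zero (FractionalIdeal.absNorm_eq_zero_iff.1 h))

/-- The action of an automorphism of `K` on the ring of integers. -/
noncomputable def conjInt (σ : K ≃ₐ[ℚ] K) : 𝓞 K ≃ₐ[ℤ] 𝓞 K :=
  (RingOfIntegers.mapRingEquiv σ).toIntAlgEquiv

@[simp] theorem coe_conjInt (σ : K ≃ₐ[ℚ] K) (x : 𝓞 K) : (conjInt σ x : K) = σ x := rfl

theorem absNorm_map_conjInt (σ : K ≃ₐ[ℚ] K) (I : Ideal (𝓞 K)) :
    Ideal.absNorm (I.map (conjInt σ)) = Ideal.absNorm I := by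
  have h := Ideal.relNorm_map_algEquiv (R := ℤ) (conjInt σ) I
  rw [Ideal.relNorm_int, Ideal.relNorm_int] at h
  simpa using congrArg Ideal.absNorm h

end AbsNorm

namespace IsImaginaryQuadratic

variable {K : Type u} [Field K] [NumberField K] {D : ℤ} {δ : K} {σ : K ≃ₐ[ℚ] K}

theorem mul_conjInt (h : IsImaginaryQuadratic D δ σ) (x : 𝓞 K) :
    x * conjInt σ x = (Algebra.norm ℤ x : ℤ) := by
  ext
  simp only [map_mul, coe_conjInt, h.mul_conj, ← Algebra.coe_norm_int, Rat.cast_intCast,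
    map_intCast]

theorem absNorm_span_natCast (h : IsImaginaryQuadratic D δ σ) (m : ℕ) :
    Ideal.absNorm (Ideal.span {(m : 𝓞 K)}) = m ^ 2 := by
  have hm := Algebra.norm_algebraMap_of_basis (RingOfIntegers.basis K) (m : ℤ)
  rw [← finrank_eq_card_basis (RingOfIntegers.basis K), RingOfIntegers.rank,
    h.finrank_eq_two, map_natCast] at hm
  rw [Ideal.absNorm_span_singleton, hm, Int.natAbs_pow, Int.natAbs_natCast]

theorem absNorm_mem_mul_map_conjInt (h : IsImaginaryQuadratic D δ σ) (I : Ideal (𝓞 K)) :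
    (Ideal.absNorm I : 𝓞 K) ∈ I * I.map (conjInt σ) := by
  have hle : Submodule.span ℤ (Algebra.norm ℤ '' (I : Set (𝓞 K))) ≤
      ((I * I.map (conjInt σ)).restrictScalars ℤ).comap (Algebra.linearMap ℤ (𝓞 K)) := by
    rw [Submodule.span_le]
    rintro _ ⟨x, hx, rfl⟩
    change algebraMap ℤ (𝓞 K) (Algebra.norm ℤ x) ∈ I * I.map (conjInt σ)
    rw [eq_intCast, ← h.mul_conjInt]
    exact Ideal.mul_mem_mul hx (Ideal.mem_map_of_mem _ hx)
  rw [← Int.cast_natCast, ← eq_intCast (algebraMap ℤ (𝓞 K))]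
  exact hle (absNorm_mem_span_norm_of_ideal I)

theorem mul_map_conjInt (h : IsImaginaryQuadratic D δ σ) (I : Ideal (𝓞 K)) :
    I * I.map (conjInt σ) = Ideal.span {(Ideal.absNorm I : 𝓞 K)} := by
  obtain rfl | hI := eq_or_ne I ⊥
  · simp
  obtain ⟨J, hJ⟩ := Ideal.dvd_iff_le.2
    ((Ideal.span_singleton_le_iff_mem _).2 (h.absNorm_mem_mul_map_conjInt I))
  have hpos : 0 < Ideal.absNorm I ^ 2 := by
    have : Ideal.absNorm I ≠ 0 := by simpa [Ideal.absNorm_eq_zero_iff] using hI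
    positivity
  have hnorm := congrArg Ideal.absNorm hJ
  rw [h.absNorm_span_natCast, map_mul, map_mul, absNorm_map_conjInt, ← pow_two] at hnorm
  have hJ1 : J = ⊤ := Ideal.absNorm_eq_one_iff.1
    (Nat.eq_of_mul_eq_mul_left hpos (by rw [← hnorm, mul_one]))
  rw [hJ, hJ1, Ideal.mul_top]

theorem absNorm_spanSingleton (h : IsImaginaryQuadratic D δ σ) {a : K} (ha : a ≠ 0) :
    FractionalIdeal.absNorm (FractionalIdeal.spanSingleton (𝓞 K)⁰ a) = Algebra.norm ℚ a := by
  rw [FractionalIdeal.absNorm_span_singleton, abs_of_pos (h.norm_pos ha)]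

theorem exists_eq_spanSingleton_mul (h : IsImaginaryQuadratic D δ σ)
    (I : FractionalIdeal (𝓞 K)⁰ K) :
    ∃ (a : K) (J : Ideal (𝓞 K)), I = FractionalIdeal.spanSingleton (𝓞 K)⁰ a * J ∧
      FractionalIdeal.absNorm I = Algebra.norm ℚ a * Ideal.absNorm J := by
  obtain ⟨a, J, ha, rfl⟩ := FractionalIdeal.exists_eq_spanSingleton_mul I
  have ha' : (algebraMap (𝓞 K) K a)⁻¹ ≠ 0 := by simpa using ha
  exact ⟨_, J, rfl, by
    rw [map_mul, h.absNorm_spanSingleton ha', FractionalIdeal.coeIdeal_absNorm]⟩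

theorem mul_conj_mem (h : IsImaginaryQuadratic D δ σ) {I : FractionalIdeal (𝓞 K)⁰ K} {x y : K}
    (hx : x ∈ I) (hy : y ∈ I) :
    x * σ y ∈ Submodule.span (𝓞 K) {((FractionalIdeal.absNorm I : ℚ) : K)} := by
  obtain ⟨a, J, rfl, hN⟩ := h.exists_eq_spanSingleton_mul I
  obtain ⟨_, ⟨x, hx', rfl⟩, rfl⟩ := FractionalIdeal.mem_singleton_mul.1 hx
  obtain ⟨_, ⟨y, hy', rfl⟩, rfl⟩ := FractionalIdeal.mem_singleton_mul.1 hy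
  have hxy := Ideal.mul_mem_mul hx' (Ideal.mem_map_of_mem (conjInt σ) hy')
  rw [h.mul_map_conjInt, Ideal.mem_span_singleton] at hxy
  obtain ⟨c, hc⟩ := hxy
  have hcK : (x : K) * σ y = Ideal.absNorm J * c := by
    simpa using congrArg (algebraMap (𝓞 K) K) hc
  refine Submodule.mem_span_singleton.2 ⟨c, ?_⟩
  rw [hN, Algebra.smul_def, Rat.cast_mul, ← h.mul_conj, Rat.cast_natCast, map_mul]
  simp only [Algebra.linearMap_apply]
  linear_combination - a * σ a * hcK

theorem absNorm_mem_span_norm (h : IsImaginaryQuadratic D δ σ) (I : FractionalIdeal (𝓞 K)⁰ K) :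
    FractionalIdeal.absNorm I ∈ Submodule.span ℤ (Algebra.norm ℚ '' {x : K | x ∈ I}) := by
  obtain ⟨a, J, rfl, hN⟩ := h.exists_eq_spanSingleton_mul I
  have hle : Submodule.span ℤ (Algebra.norm ℤ '' (J : Set (𝓞 K))) ≤
      (Submodule.span ℤ (Algebra.norm ℚ ''
        {x : K | x ∈ FractionalIdeal.spanSingleton (𝓞 K)⁰ a * J})).comap
          (LinearMap.mulLeft ℤ (Algebra.norm ℚ a) ∘ₗ Algebra.linearMap ℤ ℚ) := by
    rw [Submodule.span_le]
    rintro _ ⟨x, hx, rfl⟩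
    refine Submodule.subset_span ⟨a * x, FractionalIdeal.mem_singleton_mul.2
      ⟨x, FractionalIdeal.mem_coeIdeal_of_mem _ hx, rfl⟩, ?_⟩
    simp [← Algebra.coe_norm_int]
  rw [hN]
  simpa using hle (absNorm_mem_span_norm_of_ideal J)

theorem exists_norm_eq_mul (h : IsImaginaryQuadratic D δ σ) {I : (FractionalIdeal (𝓞 K)⁰ K)ˣ}
    {x : K} (hx : x ∈ (I : FractionalIdeal (𝓞 K)⁰ K)) :
    ∃ m : ℤ, Algebra.norm ℚ x = m * FractionalIdeal.absNorm (I : FractionalIdeal (𝓞 K)⁰ K) := by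
  obtain ⟨c, hc⟩ := Submodule.mem_span_singleton.1 (h.mul_conj_mem hx hx)
  have hN := (absNorm_unit_pos I).ne'
  set N := FractionalIdeal.absNorm (I : FractionalIdeal (𝓞 K)⁰ K)
  have hc' : algebraMap (𝓞 K) K c = (Algebra.norm ℚ x / N : ℚ) := by
    rw [Rat.cast_div, ← h.mul_conj, ← hc, Algebra.smul_def,
      mul_div_cancel_right₀ _ (by exact_mod_cast hN)]
  obtain ⟨m, hm⟩ := exists_intCast_of_isIntegral_ratCast (hc' ▸ c.isIntegral_coe)
  exact ⟨m, by rw [← hm, div_mul_cancel₀ _ hN]⟩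

theorem exists_odd_norm (h : IsImaginaryQuadratic D δ σ) (I : (FractionalIdeal (𝓞 K)⁰ K)ˣ) :
    ∃ x ∈ (I : FractionalIdeal (𝓞 K)⁰ K), ∃ m : ℤ, Odd m ∧
      Algebra.norm ℚ x = m * FractionalIdeal.absNorm (I : FractionalIdeal (𝓞 K)⁰ K) := by
  by_contra! hodd
  set N := FractionalIdeal.absNorm (I : FractionalIdeal (𝓞 K)⁰ K)
  have hle : Submodule.span ℤ (Algebra.norm ℚ '' {x : K | x ∈ (I : FractionalIdeal (𝓞 K)⁰ K)}) ≤
      Submodule.span ℤ {2 * N} := by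
    rw [Submodule.span_le]
    rintro _ ⟨x, hx, rfl⟩
    obtain ⟨m, hm⟩ := h.exists_norm_eq_mul hx
    obtain ⟨k, rfl⟩ := Int.not_odd_iff_even.1 fun ho => hodd x hx m ho hm
    exact Submodule.mem_span_singleton.2 ⟨k, by rw [hm, zsmul_eq_mul]; push_cast; ring⟩
  obtain ⟨k, hk⟩ := Submodule.mem_span_singleton.1 (hle (h.absNorm_mem_span_norm _))
  rw [zsmul_eq_mul, ← mul_assoc] at hk
  have hk1 : (k : ℚ) * 2 = 1 := (mul_eq_right₀ (absNorm_unit_pos I).ne').1 hk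
  have : k * 2 = 1 := by exact_mod_cast hk1
  omega

theorem mul_span_conj (h : IsImaginaryQuadratic D δ σ) (I : FractionalIdeal (𝓞 K)⁰ K) :
    (I : Submodule (𝓞 K) K) * Submodule.span (𝓞 K) (σ '' {a : K | a ∈ I}) =
      Submodule.span (𝓞 K) {((FractionalIdeal.absNorm I : ℚ) : K)} := by
  apply le_antisymm
  · rw [← Submodule.span_eq (I : Submodule (𝓞 K) K), Submodule.span_mul_span, Submodule.span_le]
    rintro _ ⟨x, hx, _, ⟨y, hy, rfl⟩, rfl⟩
    exact h.mul_conj_mem hx hy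
  · have hle : Submodule.span ℤ (Algebra.norm ℚ '' {x : K | x ∈ I}) ≤
        (((I : Submodule (𝓞 K) K) * Submodule.span (𝓞 K) (σ '' {a : K | a ∈ I})).restrictScalars
          ℤ).comap ((Algebra.linearMap ℚ K).restrictScalars ℤ) := by
      rw [Submodule.span_le]
      rintro _ ⟨x, hx, rfl⟩
      change ((Algebra.norm ℚ x : ℚ) : K) ∈
        (I : Submodule (𝓞 K) K) * Submodule.span (𝓞 K) (σ '' {a : K | a ∈ I})
      rw [← h.mul_conj]
      exact Submodule.mul_mem_mul hx (Submodule.subset_span ⟨x, hx, rfl⟩)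
    rw [Submodule.span_singleton_le_iff_mem]
    exact hle (h.absNorm_mem_span_norm I)

theorem mul_conj_mul_mem_one (h : IsImaginaryQuadratic D δ σ) {I J : (FractionalIdeal (𝓞 K)⁰ K)ˣ}
    {a b g : K} (ha : a ∈ (I : FractionalIdeal (𝓞 K)⁰ K))
    (hb : b ∈ (J : FractionalIdeal (𝓞 K)⁰ K))
    (hg : (FractionalIdeal.absNorm (J : FractionalIdeal (𝓞 K)⁰ K) : ℚ) * g ∈
      ((I⁻¹ * J : (FractionalIdeal (𝓞 K)⁰ K)ˣ) : FractionalIdeal (𝓞 K)⁰ K)) :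
    a * σ b * g ∈ (1 : Submodule (𝓞 K) K) := by
  have hag := FractionalIdeal.mul_mem_mul ha hg
  rw [← Units.val_mul, mul_inv_cancel_left] at hag
  obtain ⟨d, hd⟩ := Submodule.mem_span_singleton.1 (h.mul_conj_mem hag hb)
  have hN : ((FractionalIdeal.absNorm (J : FractionalIdeal (𝓞 K)⁰ K) : ℚ) : K) ≠ 0 := by
    exact_mod_cast (absNorm_unit_pos J).ne'
  refine Submodule.mem_one.2 ⟨d, mul_right_cancel₀ hN ?_⟩
  rw [← Algebra.smul_def, hd]
  ring

end IsImaginaryQuadratic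

theorem det_pow_mul_det_fromBlocks {R m n : Type*} [CommRing R] [Fintype m] [DecidableEq m]
    [Fintype n] [DecidableEq n] (A : Matrix m m R) (B : Matrix m n R) (C : Matrix n m R)
    (E : Matrix n n R) :
    A.det ^ Fintype.card n * (Matrix.fromBlocks A B C E).det =
      A.det * (A.det • E - C * A.adjugate * B).det := by
  have h : Matrix.fromBlocks 1 0 (-(C * A.adjugate)) (A.det • 1) * Matrix.fromBlocks A B C E =
      Matrix.fromBlocks A B 0 (A.det • E - C * A.adjugate * B) := by
    rw [Matrix.fromBlocks_multiply]
    congr 1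
    · simp
    · simp
    · simp [Matrix.mul_assoc, Matrix.adjugate_mul]
    · rw [Matrix.neg_mul, Matrix.smul_mul, Matrix.one_mul, neg_add_eq_sub]
  simpa [Matrix.det_mul, Matrix.det_smul] using congrArg Matrix.det h

/-- A matrix over a star ring is even hermitian if it is the Gram matrix of an even hermitian
form, i.e. it is hermitian and its diagonal consists of traces `c + star c`. Writing it as a
symmetrization makes the stability properties immediate. -/
def IsEvenHermitian {R n : Type*} [CommRing R] [StarRing R] (G : Matrix n n R) : Prop :=
  ∃ S : Matrix n n R, G = S + Sᴴ

namespace IsEvenHermitian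

section General

variable {R m n : Type*} [CommRing R] [StarRing R] {G H : Matrix n n R}

theorem of_isHermitian [LinearOrder n] (hG : G.IsHermitian)
    (hdiag : ∀ i, ∃ c, G i i = c + star c) : IsEvenHermitian G := by
  choose c hc using hdiag
  refine ⟨Matrix.of fun i j => if i < j then G i j else if i = j then c i else 0, ?_⟩
  ext i j
  rcases lt_trichotomy i j with hij | rfl | hij
  · simp [hij, hij.not_gt, hij.ne']
  · simp [hc]
  · simp [hij, hij.not_gt, hij.ne', hG.apply]

theorem isHermitian (hG : IsEvenHermitian G) : G.IsHermitian := by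
  obtain ⟨S, rfl⟩ := hG
  exact Matrix.isHermitian_add_transpose_self S

theorem exists_diag_eq (hG : IsEvenHermitian G) (i : n) : ∃ c, G i i = c + star c := by
  obtain ⟨S, rfl⟩ := hG
  exact ⟨S i i, rfl⟩

theorem submatrix (hG : IsEvenHermitian G) (f : m → n) : IsEvenHermitian (G.submatrix f f) := by
  obtain ⟨S, rfl⟩ := hG
  exact ⟨S.submatrix f f, rfl⟩

theorem sub (hG : IsEvenHermitian G) (hH : IsEvenHermitian H) : IsEvenHermitian (G - H) := by
  obtain ⟨S, rfl⟩ := hG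
  obtain ⟨T, rfl⟩ := hH
  exact ⟨S - T, by rw [Matrix.conjTranspose_sub]; abel⟩

theorem smul (hG : IsEvenHermitian G) {r : R} (hr : star r = r) : IsEvenHermitian (r • G) := by
  obtain ⟨S, rfl⟩ := hG
  exact ⟨r • S, by rw [Matrix.conjTranspose_smul, hr, smul_add]⟩

theorem conjTranspose_mul_mul [Fintype n] (hG : IsEvenHermitian G) (B : Matrix n m R) :
    IsEvenHermitian (Bᴴ * G * B) := by
  obtain ⟨S, rfl⟩ := hG
  exact ⟨Bᴴ * S * B, by
    simp only [Matrix.conjTranspose_mul, Matrix.conjTranspose_conjTranspose, Matrix.mul_add,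
      Matrix.add_mul, Matrix.mul_assoc]⟩

theorem adjugate {G : Matrix (Fin 2) (Fin 2) R} (hG : IsEvenHermitian G) :
    IsEvenHermitian G.adjugate := by
  obtain ⟨S, rfl⟩ := hG
  refine ⟨S.adjugate, ?_⟩
  ext i j
  fin_cases i <;> fin_cases j <;> simp [Matrix.adjugate_fin_two, add_comm]

theorem schur_complement {G : Matrix (Fin 2 ⊕ n) (Fin 2 ⊕ n) R} (hG : IsEvenHermitian G) :
    IsEvenHermitian (G.toBlocks₁₁.det • G.toBlocks₂₂ -
      G.toBlocks₂₁ * G.toBlocks₁₁.adjugate * G.toBlocks₁₂) := by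
  have h₁₁ : IsEvenHermitian G.toBlocks₁₁ := hG.submatrix Sum.inl
  have h₂₁ : G.toBlocks₂₁ = G.toBlocks₁₂ᴴ := by
    ext i j
    exact (hG.isHermitian.apply _ _).symm
  have hdet : star G.toBlocks₁₁.det = G.toBlocks₁₁.det := by
    rw [← Matrix.det_conjTranspose, h₁₁.isHermitian]
  rw [h₂₁]
  exact ((hG.submatrix Sum.inr).smul hdet).sub (h₁₁.adjugate.conjTranspose_mul_mul _)

end General

end IsEvenHermitian

section ZsqrtdMatrices

variable {D : ℤ}

theorem exists_intCast_of_star_eq {z : ℤ√D} (hz : star z = z) : ∃ m : ℤ, z = m := by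
  have him := congrArg Zsqrtd.im hz
  rw [Zsqrtd.im_star] at him
  exact ⟨z.re, Zsqrtd.ext (by simp) (by rw [Zsqrtd.im_intCast]; omega)⟩

theorem zsqrtd_add_star (z : ℤ√D) : z + star z = ((2 * z.re : ℤ) : ℤ√D) := by
  ext <;> simp [two_mul]

theorem zsqrtd_norm_modEq_one {z : ℤ√D} (hD : D ≡ 3 [ZMOD 4]) (hz : Odd z.norm) :
    z.norm ≡ 1 [ZMOD 4] := by
  have key : ∀ x y : ZMod 4, x * x - 3 * y * y = 0 ∨ x * x - 3 * y * y = 1 ∨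
      x * x - 3 * y * y = 2 := by decide
  have hnorm : (z.norm : ZMod 4) = z.re * z.re - 3 * z.im * z.im := by
    have hD4 : (D : ZMod 4) = (3 : ℤ) := (ZMod.intCast_eq_intCast_iff D 3 4).2 hD
    rw [Zsqrtd.norm_def]
    push_cast
    rw [hD4, Int.cast_ofNat]
  have hcases : z.norm ≡ 0 [ZMOD 4] ∨ z.norm ≡ 1 [ZMOD 4] ∨ z.norm ≡ 2 [ZMOD 4] := by
    refine (hnorm ▸ key z.re z.im).imp (fun h0 => ?_) (Or.imp (fun h1 => ?_) fun h2 => ?_)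
    · exact (ZMod.intCast_eq_intCast_iff _ 0 4).1 (by exact_mod_cast h0)
    · exact (ZMod.intCast_eq_intCast_iff _ 1 4).1 (by exact_mod_cast h1)
    · exact (ZMod.intCast_eq_intCast_iff _ 2 4).1 (by exact_mod_cast h2)
  rw [Int.odd_iff] at hz
  simp only [Int.ModEq] at hcases ⊢
  omega

/-- The ring homomorphism `ℤ√D → 𝔽₂` with `√D ↦ D`, whose kernel is the prime ideal above `2`
when `D ≢ 1 (mod 4)`. -/
def zsqrtdResidue (D : ℤ) : ℤ√D →+* ZMod 2 :=
  Zsqrtd.lift ⟨(D : ZMod 2), by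
    generalize (D : ZMod 2) = x
    revert x
    decide⟩

theorem zsqrtdResidue_eq_norm (z : ℤ√D) : zsqrtdResidue D z = (z.norm : ℤ) := by
  have key : ∀ x y d : ZMod 2, x + y * d = x * x - d * y * y := by decide
  rw [Zsqrtd.norm_def]
  push_cast
  exact key z.re z.im D

namespace IsEvenHermitian

theorem even_diag {n : Type*} {G : Matrix n n (ℤ√D)} (hG : IsEvenHermitian G) (i : n) :
    ∃ c : ℤ, G i i = ((2 * c : ℤ) : ℤ√D) := by
  obtain ⟨c, hc⟩ := hG.exists_diag_eq i
  exact ⟨c.re, hc.trans (zsqrtd_add_star c)⟩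

theorem exists_det_eq_intCast {n : Type*} [Fintype n] [DecidableEq n] {G : Matrix n n (ℤ√D)}
    (hG : IsEvenHermitian G) : ∃ d : ℤ, G.det = d :=
  exists_intCast_of_star_eq (by rw [← Matrix.det_conjTranspose, hG.isHermitian])

theorem det_fin_two {G : Matrix (Fin 2) (Fin 2) (ℤ√D)} (hG : IsEvenHermitian G) {k : ℤ}
    (hk : G.det = k) (hodd : Odd (G 0 1).norm) :
    Odd k ∧ (D ≡ 3 [ZMOD 4] → k ≡ -1 [ZMOD 4]) := by
  obtain ⟨a, ha⟩ := hG.even_diag 0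
  obtain ⟨c, hc⟩ := hG.even_diag 1
  have hdet : k = 4 * (a * c) - (G 0 1).norm := by
    have h10 : G 1 0 = star (G 0 1) := (hG.isHermitian.apply 1 0).symm
    have : (k : ℤ√D) = ((4 * (a * c) - (G 0 1).norm : ℤ) : ℤ√D) := by
      rw [← hk, Matrix.det_fin_two, ha, hc, h10, ← Zsqrtd.norm_eq_mul_conj]
      push_cast
      ring
    exact_mod_cast this
  refine ⟨?_, fun hD => ?_⟩
  · rw [Int.odd_iff] at hodd ⊢
    omega
  · have := zsqrtd_norm_modEq_one hD hodd
    rw [Int.ModEq] at this ⊢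
    omega

theorem exists_odd_norm_of_odd_det {n : ℕ} {G : Matrix (Fin (n + 1)) (Fin (n + 1)) (ℤ√D)}
    (hG : IsEvenHermitian G) {d : ℤ} (hd : G.det = d) (hodd : Odd d) :
    ∃ j, j ≠ 0 ∧ Odd (G 0 j).norm := by
  by_contra! heven
  have hres (j) : zsqrtdResidue D (G 0 j) = 0 := by
    obtain rfl | hj := eq_or_ne j 0
    · obtain ⟨c, hc⟩ := hG.even_diag 0
      rw [hc, map_intCast, ZMod.intCast_eq_zero_iff_even]
      exact even_two_mul c
    · rw [zsqrtdResidue_eq_norm, ZMod.intCast_eq_zero_iff_even, ← Int.not_odd_iff_even]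
      exact heven j hj
  have hdet : zsqrtdResidue D G.det = 0 := by
    rw [RingHom.map_det]
    exact Matrix.det_eq_zero_of_row_eq_zero 0 hres
  rw [hd, map_intCast, ZMod.intCast_eq_zero_iff_even] at hdet
  exact Int.not_even_iff_odd.2 hodd hdet

end IsEvenHermitian

theorem exists_equiv_fin_two_sum_fin {n : ℕ} {j : Fin (n + 2)} (hj : j ≠ 0) :
    ∃ e : Fin 2 ⊕ Fin n ≃ Fin (n + 2), e (Sum.inl 0) = 0 ∧ e (Sum.inl 1) = j := by
  let e₀ : Fin 2 ⊕ Fin n ≃ Fin (n + 2) := finSumFinEquiv.trans (finCongr (add_comm 2 n))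
  have h0 : e₀ (Sum.inl 0) = 0 := by
    ext
    simp [e₀]
  have h01 : (0 : Fin (n + 2)) ≠ e₀ (Sum.inl 1) := by simp [← h0]
  refine ⟨e₀.trans (Equiv.swap (e₀ (Sum.inl 1)) j), ?_, by simp⟩
  rw [Equiv.trans_apply, h0, Equiv.swap_apply_of_ne_of_ne h01 hj.symm]

-- Split off a binary block of odd determinant; its Schur complement is again even hermitian.
theorem IsEvenHermitian.even_and_det_modEq : ∀ (n : ℕ) {G : Matrix (Fin n) (Fin n) (ℤ√D)}
    (_ : IsEvenHermitian G) {d : ℤ} (_ : G.det = d) (_ : Odd d),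
    Even n ∧ (D ≡ 3 [ZMOD 4] → d ≡ (-1) ^ (n / 2) [ZMOD 4])
  | 0, G, _, d, hd, _ => by
    have : d = 1 := by
      rw [Matrix.det_isEmpty] at hd
      exact_mod_cast hd.symm
    exact ⟨Even.zero, fun _ => by rw [this]; rfl⟩
  | 1, G, hG, d, hd, hodd => by
    obtain ⟨j, hj, -⟩ := hG.exists_odd_norm_of_odd_det hd hodd
    exact absurd (Fin.fin_one_eq_zero j) hj
  | n + 2, G, hG, d, hd, hodd => by
    obtain ⟨j, hj, hjodd⟩ := hG.exists_odd_norm_of_odd_det hd hodd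
    obtain ⟨e, he0, he1⟩ := exists_equiv_fin_two_sum_fin hj
    have hG' := hG.submatrix e
    have hA : IsEvenHermitian (G.submatrix e e).toBlocks₁₁ := hG'.submatrix Sum.inl
    obtain ⟨k, hk⟩ := hA.exists_det_eq_intCast
    obtain ⟨s, hs⟩ := hG'.schur_complement.exists_det_eq_intCast
    obtain ⟨hkodd, hk4⟩ := hA.det_fin_two hk (by simpa [Matrix.toBlocks₁₁, he0, he1] using hjodd)
    have hkd : k ^ n * d = k * s := by
      have := det_pow_mul_det_fromBlocks (G.submatrix e e).toBlocks₁₁ (G.submatrix e e).toBlocks₁₂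
        (G.submatrix e e).toBlocks₂₁ (G.submatrix e e).toBlocks₂₂
      rw [Matrix.fromBlocks_toBlocks, Matrix.det_submatrix_equiv_self, hd, hs, hk,
        Fintype.card_fin] at this
      exact_mod_cast this
    have hsodd : Odd s := (Int.odd_mul.1 (hkd ▸ hkodd.pow.mul hodd)).2
    obtain ⟨hn, hmod⟩ := IsEvenHermitian.even_and_det_modEq n hG'.schur_complement hs hsodd
    refine ⟨hn.add even_two, fun hD => ?_⟩
    have hkn : k ^ n ≡ 1 [ZMOD 4] := hn.neg_one_pow (α := ℤ) ▸ (hk4 hD).pow n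
    calc d ≡ k ^ n * d [ZMOD 4] := by simpa using (hkn.mul_right d).symm
      _ ≡ -1 * (-1) ^ (n / 2) [ZMOD 4] := hkd ▸ (hk4 hD).mul (hmod hD)
      _ = (-1) ^ ((n + 2) / 2) := by rw [Nat.add_div_right n two_pos, pow_succ, mul_comm]

end ZsqrtdMatrices

section TwoAdic

theorem exists_padicInt_two_sq_eq {u : ℤ} (hu : u ≡ 1 [ZMOD 8]) :
    ∃ a : ℤ_[2], a ^ 2 = u := by
  obtain ⟨k, hk⟩ := hu.symm.dvd
  -- `a = 1 + 2 * z`, where Hensel's lemma gives the root `z ≡ 0` of `z ^ 2 + z - 2 * k`.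
  let F : Polynomial ℤ_[2] := .X ^ 2 + .X - .C (2 * k : ℤ_[2])
  have hF (z : ℤ_[2]) : Polynomial.aeval z F = z ^ 2 + z - 2 * k := by simp [F]
  have hF' : Polynomial.aeval (0 : ℤ_[2]) (Polynomial.derivative F) = 1 := by simp [F]
  have hsmall : ‖Polynomial.aeval (0 : ℤ_[2]) F‖ <
      ‖Polynomial.aeval (0 : ℤ_[2]) (Polynomial.derivative F)‖ ^ 2 := by
    have h2 : ‖(2 : ℤ_[2])‖ < 1 := by
      exact_mod_cast (PadicInt.norm_lt_one_iff_dvd (2 : ℤ_[2])).2 (by exact_mod_cast dvd_rfl)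
    rw [hF, hF', norm_one, one_pow, zero_pow two_ne_zero, zero_add, zero_sub, norm_neg, norm_mul]
    exact mul_lt_one_of_nonneg_of_lt_one_left (norm_nonneg _) h2 (PadicInt.norm_le_one _)
  obtain ⟨z, hz, -⟩ := hensels_lemma hsmall
  rw [hF] at hz
  have hu' : (u : ℤ_[2]) = 1 + 8 * k := by
    rw [eq_add_of_sub_eq' hk]
    push_cast
    rfl
  exact ⟨1 + 2 * z, by linear_combination 4 * hz - hu'⟩

theorem two_dvd_of_four_dvd_sq_sub_mul_sq {D : ℤ} (hD : D ≡ 3 [ZMOD 4]) {x y : ℤ_[2]}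
    (h : 4 ∣ x ^ 2 - D * y ^ 2) : 2 ∣ x ∧ 2 ∣ y := by
  have hker (z : ℤ_[2]) : PadicInt.toZModPow 2 z = 0 ↔ 4 ∣ z := by
    rw [← RingHom.mem_ker, PadicInt.ker_toZModPow, Ideal.mem_span_singleton]
    norm_num
  have hD4 : ((D : ℤ) : ZMod (2 ^ 2)) = 3 := by
    exact_mod_cast (ZMod.intCast_eq_intCast_iff D 3 4).2 hD
  have key : ∀ X Y : ZMod (2 ^ 2), X ^ 2 - 3 * Y ^ 2 = 0 → 2 * X = 0 ∧ 2 * Y = 0 := by decide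
  rw [← hker, map_sub, map_mul, map_pow, map_pow, map_intCast, hD4] at h
  have hhalf (z : ℤ_[2]) (hz : 2 * PadicInt.toZModPow 2 z = 0) : 2 ∣ z := by
    have h4 : 2 * 2 ∣ 2 * z := by
      rwa [← map_ofNat (PadicInt.toZModPow (p := 2) 2) 2, ← map_mul, hker, ← two_add_two_eq_four,
        ← two_mul] at hz
    exact (mul_dvd_mul_iff_left two_ne_zero).1 h4
  exact (key _ _ h).imp (hhalf x) (hhalf y)

theorem sq_sub_mul_sq_ne_four_pow_mul {D m : ℤ} (hD : D ≡ 3 [ZMOD 4]) (hm : m ≡ 3 [ZMOD 4])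
    (k : ℕ) (x y : ℤ_[2]) : x ^ 2 - D * y ^ 2 ≠ 4 ^ k * m := by
  induction k generalizing x y with
  | zero =>
    have hcast {z : ℤ} (hz : z ≡ 3 [ZMOD 4]) : (z : ZMod (2 ^ 2)) = 3 := by
      exact_mod_cast (ZMod.intCast_eq_intCast_iff z 3 4).2 hz
    have key : ∀ X Y : ZMod (2 ^ 2), X ^ 2 - 3 * Y ^ 2 ≠ 3 := by decide
    intro h
    refine key (PadicInt.toZModPow 2 x) (PadicInt.toZModPow 2 y) ?_
    simpa only [map_sub, map_mul, map_pow, map_intCast, pow_zero, one_mul, hcast hD, hcast hm]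
      using congrArg (PadicInt.toZModPow 2) h
  | succ k ih =>
    intro h
    obtain ⟨⟨x, rfl⟩, y, rfl⟩ := two_dvd_of_four_dvd_sq_sub_mul_sq hD
      (h ▸ (dvd_pow_self 4 k.succ_ne_zero).mul_right _)
    refine ih x y (mul_left_cancel₀ (by norm_num : (4 : ℤ_[2]) ≠ 0) ?_)
    linear_combination h

theorem exists_coe_eq_pow_mul (p : ℕ) [Fact p.Prime] (q : ℚ_[p]) :
    ∃ k : ℕ, ∀ l ≥ k, ∃ z : ℤ_[p], (z : ℚ_[p]) = (p : ℚ_[p]) ^ l * q := by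
  obtain ⟨k, hk⟩ := pow_unbounded_of_one_lt ‖q‖ (Nat.one_lt_cast.2 (Fact.out : p.Prime).one_lt)
  refine ⟨k, fun l hl => ⟨⟨(p : ℚ_[p]) ^ l * q, ?_⟩, rfl⟩⟩
  have hp : (1 : ℝ) ≤ p := Nat.one_le_cast.2 (Fact.out : p.Prime).one_le
  rw [norm_mul, norm_pow, Padic.norm_p, inv_pow, inv_mul_le_iff₀ (by positivity), mul_one]
  exact hk.le.trans (pow_le_pow_right₀ hp hl)

theorem sq_sub_mul_sq_ne {D m : ℤ} (hD : D ≡ 3 [ZMOD 4]) (hm : m ≡ 3 [ZMOD 4])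
    (x y : ℚ_[2]) : x ^ 2 - D * y ^ 2 ≠ m := by
  intro h
  obtain ⟨k, hk⟩ := exists_coe_eq_pow_mul 2 x
  obtain ⟨l, hl⟩ := exists_coe_eq_pow_mul 2 y
  obtain ⟨x', hx'⟩ := hk (max k l) (le_max_left k l)
  obtain ⟨y', hy'⟩ := hl (max k l) (le_max_right k l)
  refine sq_sub_mul_sq_ne_four_pow_mul hD hm (max k l) x' y' (PadicInt.ext ?_)
  have h4 : ((4 : ℤ_[2]) : ℚ_[2]) = 2 ^ 2 := (map_ofNat PadicInt.Coe.ringHom 4).trans (by norm_num)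
  push_cast at hx' hy'
  rw [PadicInt.coe_sub, PadicInt.coe_mul, PadicInt.coe_mul, PadicInt.coe_pow, PadicInt.coe_pow,
    PadicInt.coe_pow, PadicInt.coe_intCast, PadicInt.coe_intCast, h4, hx', hy', ← h, ← pow_mul,
    mul_comm 2, pow_mul]
  ring

theorem exists_sq_sub_mul_sq {D m : ℤ} (hD : D ≡ 3 [ZMOD 4]) (hm : m ≡ 1 [ZMOD 4]) :
    ∃ x y : ℚ_[2], x ^ 2 - D * y ^ 2 = m := by
  have hm8 : m ≡ 1 [ZMOD 8] ∨ m + 4 * D ≡ 1 [ZMOD 8] := by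
    simp only [Int.ModEq] at *
    omega
  rcases hm8 with hm8 | hm8 <;> obtain ⟨a, ha⟩ := exists_padicInt_two_sq_eq hm8 <;>
    replace ha : (a : ℚ_[2]) ^ 2 = _ := congrArg ((↑) : ℤ_[2] → ℚ_[2]) ha
  · exact ⟨a, 0, by simpa using ha⟩
  · rw [PadicInt.coe_intCast] at ha
    exact ⟨a, 2, by push_cast at ha; linear_combination ha⟩

theorem chi_four_eq_neg_one_pow_iff {m : ℤ} (hm : Odd m) (k : ℕ) :
    ZMod.χ₄ m = (-1) ^ k ↔ m ≡ (-1) ^ k [ZMOD 4] := by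
  rw [Int.odd_iff] at hm
  rw [ZMod.χ₄_int_eq_if_mod_four, if_neg (by omega), Int.ModEq]
  rcases neg_one_pow_eq_or ℤ k with hk | hk <;> split_ifs <;> simp [hk] <;> omega

end TwoAdic

section NormResidueSymbol

theorem isUnit_of_isUnit_norm {R A ι : Type*} [CommRing R] [CommRing A] [Algebra R A] [Finite ι]
    (b : Basis ι R A) {x : A} (hx : IsUnit (Algebra.norm R x)) : IsUnit x := by
  have := Module.Free.of_basis b
  have := Module.Finite.of_basis b
  obtain ⟨y, hy⟩ := (LinearMap.equivOfIsUnitDet hx).surjective 1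
  exact IsUnit.of_mul_eq_one y (by simpa using hy)

variable {K : Type u} [Field K] [NumberField K]

theorem norm_one_tmul (F : Type*) [Field F] [Algebra ℚ F] (γ : K) :
    Algebra.norm F (1 ⊗ₜ[ℚ] γ : F ⊗[ℚ] K) = algebraMap ℚ F (Algebra.norm ℚ γ) := by
  rw [Algebra.norm_apply, Algebra.norm_apply, ← LinearMap.det_baseChange]
  congr 1
  ext
  simp

theorem normResidueSymbol_mul_norm (p : ℕ) [Fact p.Prime] (α : ℚ_[p]) {γ : K} (hγ : γ ≠ 0) :
    normResidueSymbol K p (α * (Algebra.norm ℚ γ : ℚ)) = normResidueSymbol K p α := by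
  let u : (ℚ_[p] ⊗[ℚ] K)ˣ := Units.map Algebra.TensorProduct.includeRight.toMonoidHom
    (Units.mk0 γ hγ)
  have hu : Algebra.norm ℚ_[p] (u : ℚ_[p] ⊗[ℚ] K) = (Algebra.norm ℚ γ : ℚ) :=
    norm_one_tmul ℚ_[p] γ
  have hu0 : ((Algebra.norm ℚ γ : ℚ) : ℚ_[p]) ≠ 0 := by
    exact_mod_cast Algebra.norm_ne_zero_iff.2 hγ
  have hiff : (∃ x : (ℚ_[p] ⊗[ℚ] K)ˣ, Algebra.norm ℚ_[p] (x : ℚ_[p] ⊗[ℚ] K) =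
      α * (Algebra.norm ℚ γ : ℚ)) ↔
      ∃ x : (ℚ_[p] ⊗[ℚ] K)ˣ, Algebra.norm ℚ_[p] (x : ℚ_[p] ⊗[ℚ] K) = α :=
    ((Equiv.mulRight u).exists_congr fun x => by simp [hu, hu0]).symm
  classical
  exact if_congr hiff rfl rfl

namespace IsImaginaryQuadratic

variable {D : ℤ} {δ : K} {σ : K ≃ₐ[ℚ] K}

theorem normResidueSymbol_eq_one_iff (h : IsImaginaryQuadratic D δ σ) (p : ℕ) [Fact p.Prime]
    {α : ℚ_[p]} (hα : α ≠ 0) :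
    normResidueSymbol K p α = 1 ↔ ∃ x y : ℚ_[p], x ^ 2 - D * y ^ 2 = α := by
  let b := Algebra.TensorProduct.basis ℚ_[p] h.basis
  have hb0 : b 0 = 1 := by simp [b, Algebra.TensorProduct.one_def]
  have hb1 : b 1 ^ 2 = algebraMap ℚ_[p] _ (D : ℚ_[p]) := by
    rw [Algebra.TensorProduct.basis_apply, basis_one, Algebra.TensorProduct.tmul_pow, h.sq, one_pow,
      map_intCast]
    exact map_intCast (Algebra.TensorProduct.includeRight : K →ₐ[ℚ] ℚ_[p] ⊗[ℚ] K) D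
  have hnorm := norm_of_basis_one_sqrt b hb0 hb1
  have hsymbol : normResidueSymbol K p α = 1 ↔
      ∃ z : (ℚ_[p] ⊗[ℚ] K)ˣ, Algebra.norm ℚ_[p] (z : ℚ_[p] ⊗[ℚ] K) = α := by
    rw [normResidueSymbol]
    split_ifs with hz <;> simp [hz]
  refine hsymbol.trans ⟨fun ⟨z, hz⟩ => ⟨b.repr z 0, b.repr z 1, ?_⟩, fun ⟨x, y, hxy⟩ => ?_⟩
  · rw [← hnorm, ← Fin.sum_univ_two fun i => b.repr (z : ℚ_[p] ⊗[ℚ] K) i • b i, b.sum_repr, hz]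
  · have hz := (hnorm x y).trans hxy
    exact ⟨(isUnit_of_isUnit_norm b (hz ▸ hα.isUnit)).unit, hz⟩

theorem normResidueSymbol_two_intCast (h : IsImaginaryQuadratic D δ σ) (hD : D ≡ 3 [ZMOD 4])
    {m : ℤ} (hm : Odd m) : normResidueSymbol K 2 (m : ℚ_[2]) = ZMod.χ₄ m := by
  have hm0 : (m : ℚ_[2]) ≠ 0 := Int.cast_ne_zero.2 fun h0 => by simp [h0] at hm
  rcases (by rw [Int.odd_iff] at hm; omega : m % 4 = 1 ∨ m % 4 = 3) with hm1 | hm3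
  · rw [ZMod.χ₄_int_one_mod_four hm1, h.normResidueSymbol_eq_one_iff 2 hm0]
    exact exists_sq_sub_mul_sq hD hm1
  · rw [ZMod.χ₄_int_three_mod_four hm3, normResidueSymbol, if_neg]
    intro hex
    obtain ⟨x, y, hxy⟩ := (h.normResidueSymbol_eq_one_iff 2 hm0).1 (if_pos hex)
    exact sq_sub_mul_sq_ne hD hm3 x y hxy

end IsImaginaryQuadratic

end NormResidueSymbol

section DetPositive

variable {F : Type*} [Field F] [StarRing F] {S : Submonoid F}

theorem dotProduct_schur_complement_mem {m n : Type*} [Fintype m] [DecidableEq m] [Fintype n]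
    {A : Matrix m m F} [Invertible A] (hA : A.IsHermitian) (B : Matrix m n F)
    (E : Matrix n n F)
    (hpos : ∀ v ≠ 0, star v ⬝ᵥ Matrix.fromBlocks A B Bᴴ E *ᵥ v ∈ S) {v : n → F} (hv : v ≠ 0) :
    star v ⬝ᵥ (E - Bᴴ * A⁻¹ * B) *ᵥ v ∈ S := by
  have hv' : Sum.elim (-((A⁻¹ * B) *ᵥ v)) v ≠ 0 := fun h0 =>
    hv (funext fun i => congrFun h0 (Sum.inr i))
  have := hpos _ hv'
  rw [Matrix.dotProduct_mulVec, Matrix.schur_complement_eq₁₁ B E _ v hA, neg_add_cancel] at this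
  simpa [Matrix.dotProduct_mulVec] using this

theorem det_mem_of_forall_dotProduct_mulVec_mem (hS : 0 ∉ S) : ∀ {n : ℕ}
    {H : Matrix (Fin n) (Fin n) F} (_ : H.IsHermitian) (_ : ∀ v ≠ 0, star v ⬝ᵥ H *ᵥ v ∈ S),
    H.det ∈ S
  | 0, H, _, _ => by
    rw [Matrix.det_isEmpty]
    exact S.one_mem
  | n + 1, H, hH, hpos => by
    let e : Fin 1 ⊕ Fin n ≃ Fin (n + 1) := finSumFinEquiv.trans (finCongr (add_comm 1 n))
    let G := H.submatrix e e
    have hG : G.IsHermitian := hH.submatrix e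
    have hGpos (v) (hv : v ≠ 0) : star v ⬝ᵥ G *ᵥ v ∈ S := by
      have hv' : v ∘ e.symm ≠ 0 := fun h0 => hv (funext fun i => by simpa using congrFun h0 (e i))
      rw [Matrix.submatrix_mulVec_equiv, ← comp_equiv_symm_dotProduct]
      exact hpos _ hv'
    have h₁₁ : G.toBlocks₁₁.det ∈ S := by
      have h00 : G.toBlocks₁₁.det = G (Sum.inl 0) (Sum.inl 0) := Matrix.det_fin_one _
      rw [h00]
      simpa [Pi.star_single] using hGpos (Pi.single (Sum.inl 0) 1) (by simp)
    have : Invertible G.toBlocks₁₁.det := invertibleOfNonzero fun h0 => hS (h0 ▸ h₁₁)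
    have : Invertible G.toBlocks₁₁ := Matrix.invertibleOfDetInvertible _
    have h₂₁ : G.toBlocks₂₁ = G.toBlocks₁₂ᴴ := by
      ext i j
      exact (hG.apply _ _).symm
    have hfrom : G = Matrix.fromBlocks G.toBlocks₁₁ G.toBlocks₁₂ G.toBlocks₁₂ᴴ G.toBlocks₂₂ := by
      rw [← h₂₁, G.fromBlocks_toBlocks]
    rw [hfrom] at hG hGpos
    have hA : G.toBlocks₁₁.IsHermitian := (hH.submatrix e).submatrix Sum.inl
    have hdet : H.det = G.det := (Matrix.det_submatrix_equiv_self e H).symm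
    rw [hdet, hfrom, Matrix.det_fromBlocks₁₁, Matrix.invOf_eq_nonsing_inv]
    exact S.mul_mem h₁₁ (det_mem_of_forall_dotProduct_mulVec_mem hS
      ((Matrix.IsHermitian.fromBlocks₁₁ _ _ hA).1 hG)
      fun v hv => dotProduct_schur_complement_mem hA _ _ hGpos hv)

end DetPositive

section DetIdeals

variable {R S ι : Type*} [CommRing R] [CommRing S] [Algebra R S] [Fintype ι] [DecidableEq ι]

theorem prod_mul_prod_mul_span_det_le (A B C : ι → Submodule R S) (H : Matrix ι ι S)
    (h : ∀ i j, A i * B j * Submodule.span R {H i j} ≤ C i) :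
    (∏ i, A i) * (∏ i, B i) * Submodule.span R {H.det} ≤ ∏ i, C i := by
  have hπ (π : Equiv.Perm ι) :
      (∏ i, A i) * (∏ i, B i) * Submodule.span R {∏ i, H (π i) i} ≤ ∏ i, C i := by
    rw [← Submodule.prod_span_singleton, ← Equiv.prod_comp π A, ← Finset.prod_mul_distrib,
      ← Finset.prod_mul_distrib, ← Equiv.prod_comp π C]
    exact Finset.prod_le_prod' fun i _ => h _ _
  rw [Submodule.mul_le]
  intro c hc d hd
  obtain ⟨r, rfl⟩ := Submodule.mem_span_singleton.1 hd
  rw [mul_smul_comm, Matrix.det_apply, Finset.mul_sum]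
  refine Submodule.smul_mem _ _ (Submodule.sum_mem _ fun π _ => ?_)
  have := hπ π (Submodule.mul_mem_mul hc (Submodule.mem_span_singleton_self _))
  rw [mul_smul_comm]
  rcases Int.units_eq_one_or (Equiv.Perm.sign π) with hs | hs <;> rw [hs] <;> simpa using this

end DetIdeals

theorem classGroup_mk_eq_mk_iff_exists {R F : Type*} [CommRing R] [IsDomain R] [Field F]
    [Algebra R F] [IsFractionRing R F] {I J : (FractionalIdeal R⁰ F)ˣ} :
    ClassGroup.mk F I = ClassGroup.mk F J ↔ ∃ γ : Fˣ, I = toPrincipalIdeal R F γ * J := by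
  rw [← div_eq_one, ← map_div, ClassGroup.mk_eq_one_iff]
  constructor
  · rintro ⟨x, hx⟩
    obtain ⟨γ, hγ⟩ : I / J ∈ (toPrincipalIdeal R F).range :=
      mem_principal_ideals_iff.2
        ⟨x, FractionalIdeal.coeToSubmodule_injective (by simpa using hx.symm)⟩
    exact ⟨γ, by rw [hγ, div_mul_cancel]⟩
  · rintro ⟨γ, rfl⟩
    exact ⟨γ, by simp⟩

theorem exists_mem_ne_zero_of_unit {R F : Type*} [CommRing R] [IsDomain R] [Field F] [Algebra R F]
    [IsFractionRing R F] (I : (FractionalIdeal R⁰ F)ˣ) :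
    ∃ a ∈ (I : FractionalIdeal R⁰ F), a ≠ 0 := by
  by_contra! h
  exact I.ne_zero (FractionalIdeal.eq_zero_iff.2 h)

namespace IsImaginaryQuadratic

variable {K : Type u} [Field K] [NumberField K] {D : ℤ} {δ : K} {σ : K ≃ₐ[ℚ] K}

/-- The star ring structure on `K` given by the conjugation `σ`, in which the hermitian matrices are
those with `σ (H i j) = H j i`. -/
abbrev starRing (h : IsImaginaryQuadratic D δ σ) : StarRing K where
  star := σ
  star_involutive := h.conj_conj
  star_mul x y := by rw [map_mul, mul_comm]
  star_add := map_add σ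

theorem add_conj_mem_span_two (h : IsImaginaryQuadratic D δ σ) (hD : ¬ D ≡ 1 [ZMOD 4]) {z : K}
    (hz : z ∈ (1 : Submodule (𝓞 K) K)) : z + σ z ∈ Submodule.span (𝓞 K) {(2 : K)} := by
  obtain ⟨c, rfl⟩ := Submodule.mem_one.1 hz
  obtain ⟨r, hr⟩ := h.even_trace hD c
  refine Submodule.mem_span_singleton.2 ⟨(r : 𝓞 K), ?_⟩
  rw [h.add_conj, ← Algebra.coe_trace_int, hr, Algebra.smul_def]
  push_cast
  rw [map_intCast, mul_comm]

end IsImaginaryQuadratic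

namespace HermitianLattice

variable {K : Type u} [Field K] [NumberField K] {D : ℤ} {δ : K} {σ : K ≃ₐ[ℚ] K}
  {V : HermitianSpace K σ} {L : HermitianLattice V} {n : ℕ}

theorem form_smul_smul (a b : K) (x y : V.carrier) :
    V.form (a • x) (b • y) = a * σ b * V.form x y := by
  simp [mul_assoc, mul_left_comm]

theorem form_add_self (x y : V.carrier) :
    V.form (x + y) (x + y) = V.form x x + (V.form x y + σ (V.form x y)) + V.form y y := by
  rw [← V.form_conj y x, map_add V.form, LinearMap.add_apply, map_add, map_add]
  ring

theorem form_mem_scale {x y : V.carrier} (hx : x ∈ L.toSubmodule) (hy : y ∈ L.toSubmodule) :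
    V.form x y ∈ L.scale :=
  Submodule.subset_span ⟨x, hx, y, hy, rfl⟩

theorem IsEven.form_mem_span_two (hL : L.IsEven) {x : V.carrier} (hx : x ∈ L.toSubmodule) :
    V.form x x ∈ Submodule.span (𝓞 K) {(2 : K)} :=
  hL (Submodule.subset_span ⟨x, hx, rfl⟩)

namespace PseudoBasis

/-- The Gram matrix `(h(xᵢ,xⱼ))` of the basis underlying a pseudo-basis. -/
noncomputable def gram (P : L.PseudoBasis n) : Matrix (Fin n) (Fin n) K :=
  Matrix.of fun i j => V.form (P.basis i) (P.basis j)

theorem conj_gram (P : L.PseudoBasis n) (i j : Fin n) : σ (P.gram i j) = P.gram j i :=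
  (V.form_conj _ _).symm

theorem volume_eq (h : IsImaginaryQuadratic D δ σ) (P : L.PseudoBasis n) :
    P.volume = Submodule.span (𝓞 K)
      {((∏ i, FractionalIdeal.absNorm (P.ideal i : FractionalIdeal (𝓞 K)⁰ K) : ℚ) : K) *
        P.gram.det} := by
  rw [PseudoBasis.volume, Finset.prod_congr rfl fun i _ => h.mul_span_conj (P.ideal i : _),
    Submodule.prod_span_singleton, Submodule.span_mul_span, Set.singleton_mul_singleton]
  push_cast
  rfl

theorem smul_mem (P : L.PseudoBasis n) {i : Fin n} {a : K}
    (ha : a ∈ (P.ideal i : FractionalIdeal (𝓞 K)⁰ K)) : a • P.basis i ∈ L.toSubmodule := by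
  rw [P.mem_iff]
  intro j
  rw [map_smul, Basis.repr_self, Finsupp.smul_single, smul_eq_mul, mul_one]
  obtain rfl | hij := eq_or_ne i j
  · simpa using ha
  · rw [Finsupp.single_eq_of_ne hij.symm]
    exact FractionalIdeal.zero_mem _

theorem isOn (P : L.PseudoBasis n) : L.IsOn := by
  rw [IsOn, eq_top_iff, ← P.basis.span_eq, Submodule.span_le]
  rintro _ ⟨i, rfl⟩
  obtain ⟨a, ha, ha0⟩ := exists_mem_ne_zero_of_unit (P.ideal i)
  rw [← inv_smul_smul₀ ha0 (P.basis i)]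
  exact Submodule.smul_mem _ _ (Submodule.subset_span (P.smul_mem ha))

theorem rank_eq (P : L.PseudoBasis n) : L.rank = n := by
  rw [rank, P.isOn, finrank_top, finrank_eq_card_basis P.basis, Fintype.card_fin]

theorem prod_mul_span_det_le (P Q : L.PseudoBasis n) :
    ((∏ i, (Q.ideal i : FractionalIdeal (𝓞 K)⁰ K) : FractionalIdeal (𝓞 K)⁰ K) :
        Submodule (𝓞 K) K) * Submodule.span (𝓞 K) {(P.basis.toMatrix Q.basis).det} ≤
      ((∏ i, (P.ideal i : FractionalIdeal (𝓞 K)⁰ K) : FractionalIdeal (𝓞 K)⁰ K) :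
        Submodule (𝓞 K) K) := by
  have := prod_mul_prod_mul_span_det_le (R := 𝓞 K) (fun _ : Fin n => 1)
    (fun i => ((Q.ideal i : FractionalIdeal (𝓞 K)⁰ K) : Submodule (𝓞 K) K))
    (fun i => ((P.ideal i : FractionalIdeal (𝓞 K)⁰ K) : Submodule (𝓞 K) K))
    (P.basis.toMatrix Q.basis) (by
      intro i j
      rw [one_mul, Submodule.mul_le]
      intro b hb d hd
      obtain ⟨r, rfl⟩ := Submodule.mem_span_singleton.1 hd
      rw [mul_smul_comm]
      refine Submodule.smul_mem _ _ ?_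
      simpa [Basis.toMatrix_apply] using (P.mem_iff _).1 (Q.smul_mem hb) i)
  rw [Finset.prod_const_one, one_mul] at this
  simpa only [← FractionalIdeal.coeSubmoduleHom_apply, map_prod] using this

theorem mk_prod_eq (P Q : L.PseudoBasis n) :
    ClassGroup.mk K (∏ i, P.ideal i) = ClassGroup.mk K (∏ i, Q.ideal i) := by
  have hdet : (P.basis.toMatrix Q.basis).det * (Q.basis.toMatrix P.basis).det = 1 := by
    rw [← Matrix.det_mul, Basis.toMatrix_mul_toMatrix_flip, Matrix.det_one]
  refine classGroup_mk_eq_mk_iff_exists.2 ⟨Units.mk0 _ (left_ne_zero_of_mul_eq_one hdet),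
    Units.ext (FractionalIdeal.coeToSubmodule_injective ?_)⟩
  simp only [Units.val_mul, coe_toPrincipalIdeal, Units.val_mk0, Units.coe_prod,
    FractionalIdeal.coe_mul, FractionalIdeal.coe_spanSingleton]
  rw [mul_comm]
  refine le_antisymm ?_ (P.prod_mul_span_det_le Q)
  have := mul_le_mul' (Q.prod_mul_span_det_le P)
    (le_refl (Submodule.span (𝓞 K) {(P.basis.toMatrix Q.basis).det}))
  rwa [mul_assoc, Submodule.span_mul_span, Set.singleton_mul_singleton, mul_comm (Matrix.det _),
    hdet, ← Submodule.one_eq_span, mul_one] at this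

theorem exists_det_gram_eq (h : IsImaginaryQuadratic D δ σ) (hL : L.IsDefinite)
    (P : L.PseudoBasis n) : ∃ q : ℚ, 0 < q ∧ P.gram.det = q := by
  let := h.starRing
  have hS : 0 ∉ (Submonoid.pos ℚ).map (algebraMap ℚ K) := by
    rintro ⟨q, hq, hq0⟩
    exact hq.ne' ((map_eq_zero _).1 hq0)
  obtain ⟨q, hq, hqe⟩ := det_mem_of_forall_dotProduct_mulVec_mem hS
      (Matrix.IsHermitian.ext fun i j => P.conj_gram j i) fun v hv => by
    have hx : ∑ i, σ (v i) • P.basis i ≠ 0 := fun h0 => hv (funext fun i => by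
      simpa using Fintype.linearIndependent_iff.1 P.basis.linearIndependent _ h0 i)
    obtain ⟨q, hq, hqe⟩ := hL _ (by rw [P.isOn]; trivial) hx
    refine ⟨q, hq, hqe.symm.trans ?_⟩
    simp only [map_sum, LinearMap.sum_apply, form_smul_smul, h.conj_conj, dotProduct, Matrix.mulVec,
      Finset.mul_sum]
    rw [Finset.sum_comm]
    exact Finset.sum_congr rfl fun i _ => Finset.sum_congr rfl fun j _ => by
      rw [mul_comm (P.gram i j), ← mul_assoc]
      rfl
  exact ⟨q, hq, hqe.symm⟩

theorem prod_absNorm_mul_det_gram (h : IsImaginaryQuadratic D δ σ) (hL : L.IsDefinite)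
    (P : L.PseudoBasis n) (hvol : P.volume = 1) :
    ((∏ i, FractionalIdeal.absNorm (P.ideal i : FractionalIdeal (𝓞 K)⁰ K) : ℚ) : K) *
      P.gram.det = 1 := by
  obtain ⟨q, hq, hqe⟩ := P.exists_det_gram_eq h hL
  rw [P.volume_eq h, hqe] at hvol
  rw [hqe]
  have := eq_one_of_span_ratCast_eq_one
    (mul_pos (Finset.prod_pos fun i _ => absNorm_unit_pos (P.ideal i)) hq)
    (by rw [← hvol]; push_cast; rfl)
  exact_mod_cast this

theorem scale_eq_one (hn : n ≠ 0) (P : L.PseudoBasis n) (hint : L.scale ≤ 1)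
    (hvol : P.volume = 1) : L.scale = 1 := by
  refine hint.antisymm ?_
  rw [← hvol, PseudoBasis.volume, Finset.prod_mul_distrib]
  refine (prod_mul_prod_mul_span_det_le _ _ (fun _ => L.scale) _ fun i j => ?_).trans ?_
  · rw [← Submodule.span_eq ((P.ideal i : FractionalIdeal (𝓞 K)⁰ K) : Submodule (𝓞 K) K),
      Submodule.span_mul_span, Submodule.span_mul_span, Submodule.span_le]
    rintro _ ⟨_, ⟨a, ha, _, ⟨b, hb, rfl⟩, rfl⟩, _, rfl, rfl⟩
    have := form_mem_scale (P.smul_mem ha) (P.smul_mem hb)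
    rwa [form_smul_smul] at this
  · rw [Finset.prod_const, Finset.card_univ, Fintype.card_fin]
    exact (pow_le_pow_right_of_le_one' hint (Nat.one_le_iff_ne_zero.2 hn)).trans_eq (pow_one _)

theorem isUnimodular (h : IsImaginaryQuadratic D δ σ) (hn : n ≠ 0) (P : L.PseudoBasis n)
    (hint : L.scale ≤ 1)
    (hdet : (FractionalIdeal.absNorm ((∏ i, P.ideal i : (FractionalIdeal (𝓞 K)⁰ K)ˣ) :
      FractionalIdeal (𝓞 K)⁰ K) : K) * P.gram.det = 1) : L.IsUnimodular := by
  have hvol : P.volume = 1 := by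
    rw [P.volume_eq h, ← map_prod, ← Units.coe_prod, hdet, Submodule.one_eq_span]
  exact ⟨P.isOn, P.scale_eq_one hn hint hvol, n, P, hvol⟩

theorem scale_le_one (h : IsImaginaryQuadratic D δ σ) (P : L.PseudoBasis n)
    (hP : ∀ i j, i ≤ j →
      (FractionalIdeal.absNorm (P.ideal j : FractionalIdeal (𝓞 K)⁰ K) : ℚ) * P.gram i j ∈
        (((P.ideal i)⁻¹ * P.ideal j : (FractionalIdeal (𝓞 K)⁰ K)ˣ) :
          FractionalIdeal (𝓞 K)⁰ K)) : L.scale ≤ 1 := by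
  have hconj {z : K} (hz : z ∈ (1 : Submodule (𝓞 K) K)) : σ z ∈ (1 : Submodule (𝓞 K) K) := by
    obtain ⟨c, rfl⟩ := Submodule.mem_one.1 hz
    exact Submodule.mem_one.2 ⟨conjInt σ c, rfl⟩
  have hgram {i j : Fin n} {a b : K} (ha : a ∈ (P.ideal i : FractionalIdeal (𝓞 K)⁰ K))
      (hb : b ∈ (P.ideal j : FractionalIdeal (𝓞 K)⁰ K)) :
      a * σ b * P.gram i j ∈ (1 : Submodule (𝓞 K) K) := by
    obtain hij | hji := le_total i j
    · exact h.mul_conj_mul_mem_one ha hb (hP i j hij)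
    · have := hconj (h.mul_conj_mul_mem_one hb ha (hP j i hji))
      rwa [map_mul, map_mul, h.conj_conj, P.conj_gram, mul_comm (σ b)] at this
  rw [scale, Submodule.span_le]
  rintro _ ⟨x, hx, y, hy, rfl⟩
  rw [← P.basis.sum_repr x, ← P.basis.sum_repr y, map_sum V.form, LinearMap.sum_apply]
  refine Submodule.sum_mem _ fun i _ => ?_
  rw [map_sum]
  refine Submodule.sum_mem _ fun j _ => ?_
  rw [form_smul_smul]
  exact hgram ((P.mem_iff x).1 hx i) ((P.mem_iff y).1 hy j)

end PseudoBasis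

theorem PseudoBasis.isEven (h : IsImaginaryQuadratic D δ σ) (hD : ¬ D ≡ 1 [ZMOD 4])
    (P : L.PseudoBasis n) (hint : L.scale ≤ 1)
    (hdiag : ∀ i, (FractionalIdeal.absNorm (P.ideal i : FractionalIdeal (𝓞 K)⁰ K) : K) *
      P.gram i i ∈ Submodule.span (𝓞 K) {(2 : K)}) : L.IsEven := by
  rw [IsEven, normIdeal, Submodule.span_le]
  rintro _ ⟨x, hx, rfl⟩
  rw [P.mem_iff] at hx
  rw [← P.basis.sum_repr x]
  refine (Finset.sum_induction _
    (fun y => y ∈ L.toSubmodule ∧ V.form y y ∈ Submodule.span (𝓞 K) {(2 : K)}) ?_ ?_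
    fun i _ => ⟨P.smul_mem (hx i), ?_⟩).2
  · rintro y z ⟨hy, hy2⟩ ⟨hz, hz2⟩
    refine ⟨add_mem hy hz, ?_⟩
    rw [form_add_self]
    exact add_mem (add_mem hy2 (h.add_conj_mem_span_two hD (hint (form_mem_scale hy hz)))) hz2
  · exact ⟨zero_mem _, by simp⟩
  · obtain ⟨c, hc⟩ := Submodule.mem_span_singleton.1 (h.mul_conj_mem (hx i) (hx i))
    rw [form_smul_smul, ← hc, smul_mul_assoc]
    exact Submodule.smul_mem _ c (hdiag i)

end HermitianLattice

namespace IsImaginaryQuadratic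

variable {K : Type u} [Field K] [NumberField K] {D : ℤ} {δ : K} {σ : K ≃ₐ[ℚ] K}

/-- The embedding of `ℤ√D` into `K`; its image is `𝓞 K` if `D ≢ 1 (mod 4)`. -/
noncomputable def ofZsqrtd (h : IsImaginaryQuadratic D δ σ) : ℤ√D →+* K :=
  Zsqrtd.lift ⟨δ, by rw [← pow_two, h.sq]⟩

theorem ofZsqrtd_apply (h : IsImaginaryQuadratic D δ σ) (z : ℤ√D) :
    h.ofZsqrtd z = z.re + z.im * δ := rfl

theorem ofZsqrtd_injective (h : IsImaginaryQuadratic D δ σ) : Function.Injective h.ofZsqrtd :=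
  Zsqrtd.lift_injective _ fun n hn => by
    have := h.neg
    nlinarith [mul_self_nonneg n]

theorem ofZsqrtd_star (h : IsImaginaryQuadratic D δ σ) (z : ℤ√D) :
    h.ofZsqrtd (star z) = σ (h.ofZsqrtd z) := by
  simp [ofZsqrtd_apply, h.conj]

theorem exists_ofZsqrtd_eq (h : IsImaginaryQuadratic D δ σ) (hD : ¬ D ≡ 1 [ZMOD 4]) {x : K}
    (hx : x ∈ (1 : Submodule (𝓞 K) K)) : ∃ z, h.ofZsqrtd z = x := by
  obtain ⟨c, rfl⟩ := Submodule.mem_one.1 hx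
  obtain ⟨a, b, hab⟩ := h.exists_int_repr hD c.isIntegral_coe
  exact ⟨⟨a, b⟩, hab.symm⟩

theorem normResidueSymbol_absNorm_congr (h : IsImaginaryQuadratic D δ σ) (p : ℕ) [Fact p.Prime]
    {I J : (FractionalIdeal (𝓞 K)⁰ K)ˣ} (hIJ : ClassGroup.mk K I = ClassGroup.mk K J) :
    normResidueSymbol K p ((FractionalIdeal.absNorm (I : FractionalIdeal (𝓞 K)⁰ K) : ℚ) : ℚ_[p]) =
      normResidueSymbol K p
        ((FractionalIdeal.absNorm (J : FractionalIdeal (𝓞 K)⁰ K) : ℚ) : ℚ_[p]) := by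
  obtain ⟨γ, rfl⟩ := classGroup_mk_eq_mk_iff_exists.1 hIJ
  rw [Units.val_mul, map_mul, coe_toPrincipalIdeal, h.absNorm_spanSingleton γ.ne_zero, mul_comm,
    Rat.cast_mul, normResidueSymbol_mul_norm _ _ γ.ne_zero]

theorem normResidueSymbol_two_eq_neg_one_pow_iff (h : IsImaginaryQuadratic D δ σ)
    (hD : D ≡ 3 [ZMOD 4]) {m : ℤ} (hm : Odd m) {N : ℚ} (hN : N ≠ 0) {α : K}
    (hα : Algebra.norm ℚ α = m * N) (k : ℕ) :
    normResidueSymbol K 2 (N : ℚ_[2]) = (-1) ^ k ↔ m ≡ (-1) ^ k [ZMOD 4] := by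
  have hm0 : (m : ℚ) ≠ 0 := Int.cast_ne_zero.2 fun h0 => by simp [h0] at hm
  have hα0 : α ≠ 0 := by
    rintro rfl
    rw [Algebra.norm_zero] at hα
    exact mul_ne_zero hm0 hN hα.symm
  have hNm : N = m * Algebra.norm ℚ (α / m) := by
    have hnorm : Algebra.norm ℚ (m : K) = m ^ 2 := by simpa using h.norm_add_mul m 0
    rw [div_eq_mul_inv, map_mul, Algebra.norm_inv, hnorm, hα]
    field_simp
  rw [hNm, Rat.cast_mul, Rat.cast_intCast,
    normResidueSymbol_mul_norm 2 _ (div_ne_zero hα0 (by exact_mod_cast hm0)),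
    h.normResidueSymbol_two_intCast hD hm, chi_four_eq_neg_one_pow_iff hm]

end IsImaginaryQuadratic

namespace HermitianLattice

variable {K : Type u} [Field K] [NumberField K] {D : ℤ} {δ : K} {σ : K ≃ₐ[ℚ] K}
  {V : HermitianSpace K σ} {L : HermitianLattice V} {n : ℕ}

theorem IsEven.add_conj_mem_span_two (hL : L.IsEven) {z : K} (hz : z ∈ L.scale) :
    z + σ z ∈ Submodule.span (𝓞 K) {(2 : K)} := by
  induction hz using Submodule.closure_induction with
  | zero => simp
  | add x y _ _ hx hy =>
    rw [map_add, add_add_add_comm]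
    exact add_mem hx hy
  | smul_mem c z hz =>
    obtain ⟨x, hx, y, hy, rfl⟩ := hz
    have hcx := L.toSubmodule.smul_mem c hx
    have hform : c • V.form x y = V.form (c • x) y := by
      rw [← IsScalarTower.algebraMap_smul K c x, map_smul, LinearMap.smul_apply,
        IsScalarTower.algebraMap_smul]
    have hpolar : V.form (c • x) y + σ (V.form (c • x) y) =
        V.form (c • x + y) (c • x + y) - V.form (c • x) (c • x) - V.form y y := by
      rw [form_add_self]
      ring
    rw [hform, hpolar]
    exact sub_mem (sub_mem (hL.form_mem_span_two (add_mem hcx hy)) (hL.form_mem_span_two hcx))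
      (hL.form_mem_span_two hy)

theorem IsEven.not_modEq_one (h : IsImaginaryQuadratic D δ σ) (hL : L.IsEven)
    (hscale : L.scale = 1) : ¬ D ≡ 1 [ZMOD 4] := by
  intro hD
  have hω : (1 + δ) / 2 ∈ L.scale := hscale ▸
    Submodule.mem_one.2 ⟨⟨(1 + δ) / 2, h.isIntegral_one_add_div_two hD⟩, rfl⟩
  have htrace : (1 + δ) / 2 + σ ((1 + δ) / 2) = 1 := by
    rw [map_div₀, map_add, map_one, map_ofNat, h.conj]
    ring
  obtain ⟨c, hc⟩ := h.exists_even_intCast_of_mem_span_two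
    (htrace ▸ hL.add_conj_mem_span_two hω) (map_one σ)
  have : (1 : ℤ) = 2 * c := by exact_mod_cast hc
  omega

theorem IsEven.exists_isEvenHermitian (h : IsImaginaryQuadratic D δ σ) (hD : ¬ D ≡ 1 [ZMOD 4])
    (hL : L.IsEven) (hint : L.scale ≤ 1) {v : Fin n → V.carrier} (hv : ∀ i, v i ∈ L.toSubmodule) :
    ∃ G : Matrix (Fin n) (Fin n) (ℤ√D), IsEvenHermitian G ∧
      h.ofZsqrtd.mapMatrix G = Matrix.of fun i j => V.form (v i) (v j) := by
  choose G hG using fun i j => h.exists_ofZsqrtd_eq hD (hint (form_mem_scale (hv i) (hv j)))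
  refine ⟨Matrix.of G, IsEvenHermitian.of_isHermitian ?_ fun i => ?_, Matrix.ext hG⟩
  · refine Matrix.IsHermitian.ext fun i j => h.ofZsqrtd_injective ?_
    rw [h.ofZsqrtd_star, Matrix.of_apply, Matrix.of_apply, hG, hG, ← V.form_conj]
  · obtain ⟨c, hc⟩ := h.exists_even_intCast_of_mem_span_two (hL.form_mem_span_two (hv i))
      (V.form_conj _ _).symm
    refine ⟨c, h.ofZsqrtd_injective ?_⟩
    rw [Matrix.of_apply, hG, hc, map_add, h.ofZsqrtd_star, map_intCast, map_intCast]
    push_cast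
    ring

theorem PseudoBasis.det_form_smul_smul (P : L.PseudoBasis n) (a : Fin n → K) :
    (Matrix.of fun i j => V.form (a i • P.basis i) (a j • P.basis j)).det =
      (∏ i, a i * σ (a i)) * P.gram.det := by
  rw [Finset.prod_mul_distrib, mul_assoc, ← Matrix.det_mul_row, ← Matrix.det_mul_column]
  congr 1
  ext i j
  simp only [Matrix.of_apply, form_smul_smul, gram, mul_assoc]

theorem IsEven.exists_norm_eq_mul (h : IsImaginaryQuadratic D δ σ) (hL : L.IsEven)
    (hdef : L.IsDefinite) (hscale : L.scale = 1) (P : L.PseudoBasis n) (hvol : P.volume = 1) :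
    Even n ∧ ∃ m : ℤ, Odd m ∧ (D ≡ 3 [ZMOD 4] → m ≡ (-1) ^ (n / 2) [ZMOD 4]) ∧
      ∃ α : K, Algebra.norm ℚ α = m * FractionalIdeal.absNorm
        ((∏ i, P.ideal i : (FractionalIdeal (𝓞 K)⁰ K)ˣ) : FractionalIdeal (𝓞 K)⁰ K) := by
  choose a ha m hm hN using fun i => h.exists_odd_norm (P.ideal i)
  obtain ⟨G, hG, hGmap⟩ := hL.exists_isEvenHermitian h (hL.not_modEq_one h hscale) hscale.le
    fun i => P.smul_mem (ha i)
  have hdet : G.det = ((∏ i, m i : ℤ) : ℤ√D) := by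
    apply h.ofZsqrtd_injective
    rw [map_intCast, RingHom.map_det, hGmap, P.det_form_smul_smul]
    simp only [h.mul_conj, hN, Rat.cast_mul, Rat.cast_intCast, Finset.prod_mul_distrib]
    rw [mul_assoc, ← Rat.cast_prod, P.prod_absNorm_mul_det_gram h hdef hvol, mul_one,
      Int.cast_prod]
  have hodd : Odd (∏ i, m i) :=
    Finset.prod_induction _ _ (fun _ _ => Odd.mul) odd_one fun i _ => hm i
  obtain ⟨hn, hmod⟩ := hG.even_and_det_modEq n hdet hodd
  refine ⟨hn, ∏ i, m i, hodd, hmod, ∏ i, a i, ?_⟩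
  rw [map_prod, Finset.prod_congr rfl fun i _ => hN i, Finset.prod_mul_distrib, Units.coe_prod,
    map_prod, Int.cast_prod]

theorem IsEven.normResidueSymbol_eq (h : IsImaginaryQuadratic D δ σ) (hL : L.IsEven)
    (hdef : L.IsDefinite) (hscale : L.scale = 1) (P : L.PseudoBasis n) (hvol : P.volume = 1)
    (hD : D ≡ 3 [ZMOD 4]) :
    normResidueSymbol K 2 ((FractionalIdeal.absNorm ((∏ i, P.ideal i :
      (FractionalIdeal (𝓞 K)⁰ K)ˣ) : FractionalIdeal (𝓞 K)⁰ K) : ℚ) : ℚ_[2]) =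
        (-1) ^ (n / 2) := by
  obtain ⟨-, m, hm, hmod, α, hα⟩ := hL.exists_norm_eq_mul h hdef hscale P hvol
  exact (h.normResidueSymbol_two_eq_neg_one_pow_iff hD hm (absNorm_unit_pos _).ne' hα _).2 (hmod hD)

theorem IsEven.even_and_normResidueSymbol_eq (h : IsImaginaryQuadratic D δ σ) (hL : L.IsEven)
    (hdef : L.IsDefinite) (huni : L.IsUnimodular) {𝔞 : (FractionalIdeal (𝓞 K)⁰ K)ˣ}
    (hst : L.HasSteinitzClass (ClassGroup.mk K 𝔞)) :
    Even L.rank ∧ (D ≡ 3 [ZMOD 4] →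
      normResidueSymbol K 2
        ((FractionalIdeal.absNorm (𝔞 : FractionalIdeal (𝓞 K)⁰ K) : ℚ) : ℚ_[2]) =
          (-1) ^ (L.rank / 2)) := by
  obtain ⟨-, hscale, k, P, hvol⟩ := huni
  obtain ⟨l, Q, hQ⟩ := hst
  obtain rfl : k = l := P.rank_eq.symm.trans Q.rank_eq
  rw [P.rank_eq, ← h.normResidueSymbol_absNorm_congr 2 ((P.mk_prod_eq Q).trans hQ)]
  exact ⟨(hL.exists_norm_eq_mul h hdef hscale P hvol).1,
    hL.normResidueSymbol_eq h hdef hscale P hvol⟩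

end HermitianLattice

namespace HermitianLattice

variable {K : Type u} [Field K] [NumberField K] {σ : K ≃ₐ[ℚ] K} {V : HermitianSpace K σ} {n : ℕ}

/-- The lattice `𝔞₁x₁ + ⋯ + 𝔞ₙxₙ` for a basis `x₁, …, xₙ` and fractional ideals `𝔞₁, …, 𝔞ₙ`. -/
noncomputable def ofBasis (b : Basis (Fin n) K V.carrier)
    (I : Fin n → (FractionalIdeal (𝓞 K)⁰ K)ˣ) : HermitianLattice V where
  toSubmodule := (Submodule.pi Set.univ fun i =>
    ((I i : FractionalIdeal (𝓞 K)⁰ K) : Submodule (𝓞 K) K)).map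
      (b.equivFun.symm.restrictScalars (𝓞 K)).toLinearMap
  fg := Submodule.FG.map _ (Submodule.fg_pi fun i =>
    FractionalIdeal.fg_of_isUnit _ (I i).isUnit)

/-- The pseudo-basis from which `ofBasis` is built. -/
noncomputable def ofBasisPseudoBasis (b : Basis (Fin n) K V.carrier)
    (I : Fin n → (FractionalIdeal (𝓞 K)⁰ K)ˣ) : (ofBasis b I).PseudoBasis n where
  basis := b
  ideal := I
  mem_iff v := by
    constructor
    · rintro ⟨x, hx, rfl⟩ i
      have hrepr : b.repr (b.equivFun.symm x) i = x i := by
        rw [← b.equivFun_apply, LinearEquiv.apply_symm_apply]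
      exact hrepr.symm ▸ hx i (Set.mem_univ i)
    · intro hv
      exact ⟨b.equivFun v, fun i _ => hv i, b.equivFun.symm_apply_apply v⟩

end HermitianLattice

namespace IsImaginaryQuadratic

variable {K : Type u} [Field K] [NumberField K] {D : ℤ} {δ : K} {σ : K ≃ₐ[ℚ] K} {n : ℕ}

/-- The hermitian space `Kⁿ` with the form `∑ dᵢ xᵢ σ(yᵢ)`. -/
noncomputable def diagSpace (h : IsImaginaryQuadratic D δ σ) (d : Fin n → ℚ) :
    HermitianSpace K σ where
  carrier := Fin n → K
  form := LinearMap.mk₂'ₛₗ (RingHom.id K) (σ : K →+* K) (fun x y => ∑ i, d i * x i * σ (y i))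
    (fun x x' y => by simp [mul_add, add_mul, Finset.sum_add_distrib])
    (fun c x y => by
      simp only [Pi.smul_apply, smul_eq_mul, RingHom.id_apply, Finset.mul_sum]
      exact Finset.sum_congr rfl fun i _ => by ring)
    (fun x y y' => by simp [mul_add, Finset.sum_add_distrib])
    (fun c x y => by
      simp only [Pi.smul_apply, smul_eq_mul, Finset.mul_sum, map_mul, RingHom.coe_coe]
      exact Finset.sum_congr rfl fun i _ => by ring)
  form_conj x y := by
    simp only [LinearMap.mk₂'ₛₗ_apply, map_sum, map_mul, h.conj_conj, map_ratCast]
    exact Finset.sum_congr rfl fun i _ => by ring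

theorem diagSpace_form (h : IsImaginaryQuadratic D δ σ) (d : Fin n → ℚ) (x y : Fin n → K) :
    (h.diagSpace d).form x y = ∑ i, d i * x i * σ (y i) := rfl

theorem diagSpace_form_single (h : IsImaginaryQuadratic D δ σ) (d : Fin n → ℚ) (x : Fin n → K)
    (i : Fin n) (c : K) :
    (h.diagSpace d).form x (Pi.single i c : Fin n → K) = d i * x i * σ c := by
  rw [diagSpace_form, Finset.sum_eq_single i (fun j _ hj => by simp [hj]) (by simp),
    Pi.single_eq_same]

theorem isDefinite_diagSpace (h : IsImaginaryQuadratic D δ σ) {d : Fin n → ℚ} (hd : ∀ i, 0 < d i)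
    (L : HermitianLattice (h.diagSpace d)) : L.IsDefinite := by
  intro (x : Fin n → K) _ hx
  refine ⟨∑ i, d i * Algebra.norm ℚ (x i), ?_, ?_⟩
  · obtain ⟨i, hi⟩ := Function.ne_iff.1 hx
    refine Finset.sum_pos' (fun j _ => ?_) ⟨i, Finset.mem_univ i, mul_pos (hd i) (h.norm_pos hi)⟩
    obtain hj | hj := eq_or_ne (x j) 0
    · rw [hj, Algebra.norm_zero, mul_zero]
    · exact (mul_pos (hd j) (h.norm_pos hj)).le
  · rw [h.diagSpace_form, eq_ratCast]
    push_cast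
    exact Finset.sum_congr rfl fun i _ => by rw [mul_assoc, h.mul_conj]

section rowLattice

variable (h : IsImaginaryQuadratic D δ σ) (d : Fin n → ℚ) {T : Matrix (Fin n) (Fin n) K}
  (hT : T.det = 1) (I : Fin n → (FractionalIdeal (𝓞 K)⁰ K)ˣ)

open Classical in
/-- The basis of `h.diagSpace d` formed by the rows of a matrix of determinant one. -/
noncomputable def rowBasis : Basis (Fin n) K (h.diagSpace d).carrier :=
  basisOfPiSpaceOfLinearIndependent
    (Matrix.linearIndependent_rows_of_det_ne_zero (A := T) (hT ▸ one_ne_zero))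

theorem rowBasis_apply (i : Fin n) : h.rowBasis d hT i = T.row i :=
  congrFun (coe_basisOfPiSpaceOfLinearIndependent _) i

/-- The lattice in `h.diagSpace d` spanned by the rows of `T` with coefficients in the `I i`. -/
noncomputable abbrev rowLattice : HermitianLattice (h.diagSpace d) :=
  HermitianLattice.ofBasis (h.rowBasis d hT) I

/-- The pseudo-basis of `h.rowLattice d hT I` given by the rows of `T`. -/
noncomputable abbrev rowPseudoBasis : (h.rowLattice d hT I).PseudoBasis n :=
  HermitianLattice.ofBasisPseudoBasis (h.rowBasis d hT) I

theorem gram_rowPseudoBasis (i j : Fin n) :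
    (h.rowPseudoBasis d hT I).gram i j = (h.diagSpace d).form (T.row i) (T.row j) := by
  rw [← h.rowBasis_apply d hT i, ← h.rowBasis_apply d hT j]
  rfl

theorem det_gram_rowPseudoBasis : (h.rowPseudoBasis d hT I).gram.det = ∏ i, (d i : K) := by
  have hgram : (h.rowPseudoBasis d hT I).gram =
      T * Matrix.diagonal (fun i => (d i : K)) * (T.map σ)ᵀ := by
    ext i j
    rw [h.gram_rowPseudoBasis, h.diagSpace_form, Matrix.mul_apply]
    simp only [Matrix.mul_diagonal, Matrix.transpose_apply, Matrix.map_apply, Matrix.row_apply]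
    exact Finset.sum_congr rfl fun l _ => by ring
  have hσ : (T.map σ).det = 1 := by
    rw [← map_one (σ : K →+* K), ← hT, RingHom.map_det]
    rfl
  rw [hgram, Matrix.det_mul, Matrix.det_mul, Matrix.det_diagonal, Matrix.det_transpose, hσ, hT,
    one_mul, mul_one]

theorem isUnimodular_rowLattice (hn : n ≠ 0) (hint : (h.rowLattice d hT I).scale ≤ 1)
    (hd : FractionalIdeal.absNorm ((∏ i, I i : (FractionalIdeal (𝓞 K)⁰ K)ˣ) :
      FractionalIdeal (𝓞 K)⁰ K) * ∏ i, d i = 1) : (h.rowLattice d hT I).IsUnimodular := by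
  refine (h.rowPseudoBasis d hT I).isUnimodular h hn hint ?_
  rw [h.det_gram_rowPseudoBasis, ← Rat.cast_prod]
  exact_mod_cast hd

end rowLattice

section diagLattice

variable (h : IsImaginaryQuadratic D δ σ) (I : Fin n → (FractionalIdeal (𝓞 K)⁰ K)ˣ)

/-- The orthogonal sum of the ideals `I i`, each with the rank one form `x σ(y) / N(I i)`. -/
noncomputable abbrev diagLattice :
    HermitianLattice (h.diagSpace fun i =>
      (FractionalIdeal.absNorm (I i : FractionalIdeal (𝓞 K)⁰ K))⁻¹) :=
  h.rowLattice _ (T := 1) Matrix.det_one I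

/-- The standard basis as a pseudo-basis of `h.diagLattice I`. -/
noncomputable abbrev diagPseudoBasis : (h.diagLattice I).PseudoBasis n :=
  h.rowPseudoBasis _ (T := 1) Matrix.det_one I

theorem absNorm_mul_gram_diagPseudoBasis (i j : Fin n) :
    (FractionalIdeal.absNorm (I j : FractionalIdeal (𝓞 K)⁰ K) : K) *
      (h.diagPseudoBasis I).gram i j = (1 : Matrix (Fin n) (Fin n) K) i j := by
  have hN : (FractionalIdeal.absNorm (I j : FractionalIdeal (𝓞 K)⁰ K) : K) ≠ 0 :=
    Rat.cast_ne_zero.2 (absNorm_unit_pos _).ne'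
  have hrow : (1 : Matrix (Fin n) (Fin n) K).row j = Pi.single j 1 :=
    funext fun _ => Matrix.one_eq_pi_single
  rw [h.gram_rowPseudoBasis, hrow, diagSpace_form_single, map_one, mul_one, Rat.cast_inv,
    mul_inv_cancel_left₀ hN, Matrix.row_apply]

theorem scale_diagLattice_le_one : (h.diagLattice I).scale ≤ 1 :=
  (h.diagPseudoBasis I).scale_le_one h fun i j _ => by
    refine (h.absNorm_mul_gram_diagPseudoBasis I i j).symm ▸ ?_
    obtain rfl | hij := eq_or_ne i j
    · rw [Matrix.one_apply_eq, inv_mul_cancel, Units.val_one]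
      exact FractionalIdeal.one_mem_one _
    · rw [Matrix.one_apply_ne hij]
      exact FractionalIdeal.zero_mem _

theorem isUnimodular_diagLattice (hn : n ≠ 0) : (h.diagLattice I).IsUnimodular := by
  refine h.isUnimodular_rowLattice _ _ _ hn (h.scale_diagLattice_le_one I) ?_
  rw [Units.coe_prod, map_prod, Finset.prod_inv_distrib, mul_inv_cancel₀]
  exact (Finset.prod_pos fun i _ => absNorm_unit_pos (I i)).ne'

theorem isOdd_diagLattice (hn : n ≠ 0) : (h.diagLattice I).IsOdd := by
  intro heven
  let i : Fin n := ⟨0, Nat.pos_of_ne_zero hn⟩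
  obtain ⟨t, ht, m, hm, hNt⟩ := h.exists_odd_norm (I i)
  obtain ⟨c, hc⟩ := h.exists_even_intCast_of_mem_span_two
    (heven.form_mem_span_two ((h.diagPseudoBasis I).smul_mem ht))
    (HermitianSpace.form_conj _ _ _).symm
  have hgram := h.absNorm_mul_gram_diagPseudoBasis I i i
  have : m = 2 * c := by
    rw [HermitianLattice.form_smul_smul, h.mul_conj, hNt, Rat.cast_mul, mul_assoc] at hc
    have hmc := (congrArg (_ * ·) (hgram.trans (Matrix.one_apply_eq i))).symm.trans hc
    rw [mul_one, Rat.cast_intCast] at hmc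
    exact Int.cast_injective hmc
  exact (Int.not_odd_iff_even.2 (this ▸ even_two_mul c)) hm

end diagLattice

theorem exists_odd_unimodular (h : IsImaginaryQuadratic D δ σ) (𝔞 : (FractionalIdeal (𝓞 K)⁰ K)ˣ)
    (hn : n ≠ 0) : ∃ (V : HermitianSpace K σ) (L : HermitianLattice V),
      L.IsDefinite ∧ L.IsOdd ∧ L.IsUnimodular ∧ L.rank = n ∧
        L.HasSteinitzClass (ClassGroup.mk K 𝔞) := by
  let I : Fin n → (FractionalIdeal (𝓞 K)⁰ K)ˣ := Pi.mulSingle ⟨0, Nat.pos_of_ne_zero hn⟩ 𝔞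
  have hprod : ∏ i, I i = 𝔞 := by
    rw [Finset.prod_pi_mulSingle', if_pos (Finset.mem_univ _)]
  exact ⟨_, h.diagLattice I, h.isDefinite_diagSpace (fun i => inv_pos.2 (absNorm_unit_pos _)) _,
    h.isOdd_diagLattice I hn, h.isUnimodular_diagLattice I hn, (h.diagPseudoBasis I).rank_eq,
    n, h.diagPseudoBasis I, congrArg _ hprod⟩

end IsImaginaryQuadratic

namespace IsImaginaryQuadratic

variable {K : Type u} [Field K] [NumberField K] {D : ℤ} {δ : K} {σ : K ≃ₐ[ℚ] K}

theorem exists_ideal_mul_self_eq_span_two (h : IsImaginaryQuadratic D δ σ)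
    (hD : ¬ D ≡ 1 [ZMOD 4]) : ∃ P : Ideal (𝓞 K), P * P = Ideal.span {(2 : 𝓞 K)} := by
  obtain ⟨d, hd⟩ : ∃ d : 𝓞 K, (d : K) = δ := ⟨⟨δ, h.isIntegral_sqrt⟩, rfl⟩
  have hd2 : d ^ 2 = D := by
    ext
    simp [hd, h.sq]
  obtain ⟨c, hc⟩ : ∃ c, D * (D + 1) = 2 * c := (Int.even_mul_succ_self D).two_dvd
  obtain ⟨j, hj⟩ : ∃ j, D * (D - 1) = 4 * j + 2 := by
    obtain hD | hD := h.emod_four hD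
    · obtain ⟨j, rfl⟩ : ∃ j, D = 4 * j + 2 := ⟨D / 4, by omega⟩
      exact ⟨4 * j ^ 2 + 3 * j, by ring⟩
    · obtain ⟨j, rfl⟩ : ∃ j, D = 4 * j + 3 := ⟨D / 4, by omega⟩
      exact ⟨4 * j ^ 2 + 5 * j + 1, by ring⟩
  have hcK : (D * (D + 1) : 𝓞 K) = 2 * c := by exact_mod_cast congrArg (Int.cast (R := 𝓞 K)) hc
  have hjK : (D * (D - 1) : 𝓞 K) = 4 * j + 2 := by
    exact_mod_cast congrArg (Int.cast (R := 𝓞 K)) hj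
  have hsq : (D + d) * (D + d) = 2 * (c + D * d) := by linear_combination hd2 + hcK
  have htwo : 2 = D * (2 * (D + d)) - (D + d) * (D + d) - j * (2 * 2) := by
    linear_combination hd2 - hjK
  refine ⟨Ideal.span {2, D + d}, ?_⟩
  rw [Ideal.span_pair_mul_span_pair]
  apply le_antisymm
  · simp only [Ideal.span_le, Set.insert_subset_iff, Set.singleton_subset_iff, SetLike.mem_coe,
      Ideal.mem_span_singleton, hsq, dvd_mul_right, dvd_mul_left, and_self]
  · rw [Ideal.span_singleton_le_iff_mem]
    refine (congrArg (· ∈ _) htwo).mpr ?_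
    refine sub_mem (sub_mem (Ideal.mul_mem_left _ _ ?_) ?_) (Ideal.mul_mem_left _ _ ?_)
    all_goals exact Ideal.subset_span (by simp)

theorem exists_unit_two_mem_mul_self (h : IsImaginaryQuadratic D δ σ) (hD : ¬ D ≡ 1 [ZMOD 4]) :
    ∃ P : (FractionalIdeal (𝓞 K)⁰ K)ˣ,
      FractionalIdeal.absNorm (P : FractionalIdeal (𝓞 K)⁰ K) = 2 ∧
      (2 : K) ∈ (P : FractionalIdeal (𝓞 K)⁰ K) ∧
      (2 : K) ∈ ((P * P : (FractionalIdeal (𝓞 K)⁰ K)ˣ) : FractionalIdeal (𝓞 K)⁰ K) := by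
  obtain ⟨P, hP⟩ := h.exists_ideal_mul_self_eq_span_two hD
  have htwo : (2 : 𝓞 K) ∈ P * P := hP ▸ Ideal.mem_span_singleton_self 2
  have hnorm : Ideal.absNorm P = 2 := by
    have := congrArg Ideal.absNorm hP
    rw [map_mul, ← Nat.cast_two, h.absNorm_span_natCast 2, ← pow_two] at this
    exact Nat.pow_left_injective two_ne_zero this
  have hP0 : (P : FractionalIdeal (𝓞 K)⁰ K) ≠ 0 := by
    rw [ne_eq, FractionalIdeal.coeIdeal_eq_zero]
    rintro rfl
    simp at hnorm
  refine ⟨Units.mk0 _ hP0, ?_, ?_, ?_⟩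
  · rw [Units.val_mk0, FractionalIdeal.coeIdeal_absNorm, hnorm, Nat.cast_two]
  · exact (FractionalIdeal.mem_coeIdeal _).2 ⟨2, Ideal.mul_le_left htwo, map_ofNat _ 2⟩
  · rw [Units.val_mul, Units.val_mk0, ← FractionalIdeal.coeIdeal_mul]
    exact (FractionalIdeal.mem_coeIdeal _).2 ⟨2, htwo, map_ofNat _ 2⟩

end IsImaginaryQuadratic

section Neighbor

variable {K : Type u} [Field K] {k : ℕ} {t : K} {i : Fin (k + 2)}

/-- The matrix with rows `(1,…,1,t)`, `eᵢ - t eₙ` for `1 < i < n`, and `eₙ`, where `n = k + 2`. -/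
def neighborMatrix (k : ℕ) (t : K) : Matrix (Fin (k + 2)) (Fin (k + 2)) K :=
  Matrix.of fun i =>
    if i = 0 then Function.update 1 (Fin.last _) t
    else if i = Fin.last _ then Pi.single (Fin.last _) 1
    else Pi.single i 1 - Pi.single (Fin.last _) t

theorem neighborMatrix_row_zero :
    (neighborMatrix k t).row 0 = Function.update (1 : Fin (k + 2) → K) (Fin.last _) t :=
  funext fun _ => by simp [neighborMatrix]

theorem neighborMatrix_row_last :
    (neighborMatrix k t).row (Fin.last _) = Pi.single (Fin.last _) 1 :=
  funext fun _ => by simp [neighborMatrix]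

theorem neighborMatrix_row_of_ne (h0 : i ≠ 0) (hl : i ≠ Fin.last _) :
    (neighborMatrix k t).row i = Pi.single i 1 - Pi.single (Fin.last _) t :=
  (if_neg h0).trans (if_neg hl)

theorem det_neighborMatrix : (neighborMatrix k t).det = 1 := by
  rw [Matrix.det_of_isUpperTriangular]
  · refine Finset.prod_eq_one fun i _ => ?_
    obtain rfl | h0 := eq_or_ne i 0
    · exact (congrFun neighborMatrix_row_zero 0).trans (by simp [Fin.last_pos.ne])
    obtain rfl | hl := eq_or_ne i (Fin.last _)
    · exact (congrFun neighborMatrix_row_last _).trans (by simp)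
    · exact (congrFun (neighborMatrix_row_of_ne h0 hl) i).trans (by simp [hl])
  · intro i j (hji : j < i)
    have h0 : i ≠ 0 := (Fin.zero_le j |>.trans_lt hji).ne'
    obtain rfl | hl := eq_or_ne i (Fin.last _)
    · exact (congrFun neighborMatrix_row_last j).trans (by simp [hji.ne])
    · have hjl : j ≠ Fin.last _ := (hji.trans_le (Fin.le_last i)).ne
      exact (congrFun (neighborMatrix_row_of_ne h0 hl) j).trans (by simp [hji.ne, hjl])

/-- The family `(𝔭⁻¹, 𝒪, …, 𝒪, 𝔭𝔞)` of `k + 2` ideals. -/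
noncomputable def neighborIdeal {G : Type*} [CommGroup G] (k : ℕ) (𝔭 𝔞 : G) : Fin (k + 2) → G :=
  Pi.mulSingle 0 𝔭⁻¹ * Pi.mulSingle (Fin.last _) (𝔭 * 𝔞)

variable {G : Type*} [CommGroup G] {𝔭 𝔞 : G}

theorem neighborIdeal_zero : neighborIdeal k 𝔭 𝔞 0 = 𝔭⁻¹ := by
  simp [neighborIdeal, Fin.last_pos.ne]

theorem neighborIdeal_last : neighborIdeal k 𝔭 𝔞 (Fin.last _) = 𝔭 * 𝔞 := by
  simp [neighborIdeal, Fin.last_pos.ne']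

theorem neighborIdeal_of_ne (h0 : i ≠ 0) (hl : i ≠ Fin.last _) : neighborIdeal k 𝔭 𝔞 i = 1 := by
  simp [neighborIdeal, h0, hl]

theorem prod_neighborIdeal : ∏ i, neighborIdeal k 𝔭 𝔞 i = 𝔞 := by
  simp [neighborIdeal, Finset.prod_mul_distrib, Finset.prod_pi_mulSingle']

end Neighbor

namespace IsImaginaryQuadratic

variable {K : Type u} [Field K] [NumberField K] {D : ℤ} {δ : K} {σ : K ≃ₐ[ℚ] K} {k : ℕ}
  (h : IsImaginaryQuadratic D δ σ) (𝔭 𝔞 : (FractionalIdeal (𝓞 K)⁰ K)ˣ) (t : K)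

/-- The neighbour at `𝔭` of the lattice `⟨1⟩ ⊥ ⋯ ⊥ ⟨1⟩ ⊥ 𝔞`, whose last summand carries the form
`x σ(y) / N(𝔞)`, along the vector `(1,…,1,t)`. -/
noncomputable abbrev neighborLattice (k : ℕ) : HermitianLattice (h.diagSpace
    (Pi.mulSingle (Fin.last (k + 1)) (FractionalIdeal.absNorm (𝔞 : FractionalIdeal (𝓞 K)⁰ K))⁻¹)) :=
  h.rowLattice _ (det_neighborMatrix (t := t)) (neighborIdeal k 𝔭 𝔞)

/-- The pseudo-basis of `h.neighborLattice 𝔭 𝔞 t k` given by the rows of `neighborMatrix k t`. -/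
noncomputable abbrev neighborPseudoBasis (k : ℕ) :
    (h.neighborLattice 𝔭 𝔞 t k).PseudoBasis (k + 2) :=
  h.rowPseudoBasis _ (det_neighborMatrix (t := t)) (neighborIdeal k 𝔭 𝔞)

theorem gram_neighborPseudoBasis_last (i : Fin (k + 2)) :
    (h.neighborPseudoBasis 𝔭 𝔞 t k).gram i (Fin.last _) =
      (neighborMatrix k t).row i (Fin.last _) /
        FractionalIdeal.absNorm (𝔞 : FractionalIdeal (𝓞 K)⁰ K) := by
  rw [h.gram_rowPseudoBasis, neighborMatrix_row_last, diagSpace_form_single, Pi.mulSingle_eq_same,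
    map_one, mul_one, Rat.cast_inv, div_eq_inv_mul]

theorem gram_neighborPseudoBasis_of_ne (i : Fin (k + 2)) {j : Fin (k + 2)} (h0 : j ≠ 0)
    (hl : j ≠ Fin.last _) :
    (h.neighborPseudoBasis 𝔭 𝔞 t k).gram i j =
      (neighborMatrix k t).row i j - (neighborMatrix k t).row i (Fin.last _) * σ t /
        FractionalIdeal.absNorm (𝔞 : FractionalIdeal (𝓞 K)⁰ K) := by
  rw [h.gram_rowPseudoBasis, neighborMatrix_row_of_ne h0 hl]
  refine (((h.diagSpace _).form _).map_sub _ _).trans ?_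
  refine congrArg₂ (· - ·) ((h.diagSpace_form_single _ _ _ _).trans ?_)
    ((h.diagSpace_form_single _ _ _ _).trans ?_)
  · rw [Pi.mulSingle_eq_of_ne hl, Rat.cast_one, one_mul, map_one, mul_one]
  · rw [Pi.mulSingle_eq_same, Rat.cast_inv, mul_assoc, div_eq_inv_mul]

variable {t} {m : ℤ} (hNt : Algebra.norm ℚ t =
  m * FractionalIdeal.absNorm (𝔞 : FractionalIdeal (𝓞 K)⁰ K))

include h hNt in
theorem mul_conj_div_absNorm :
    t * σ t / FractionalIdeal.absNorm (𝔞 : FractionalIdeal (𝓞 K)⁰ K) = m := by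
  rw [h.mul_conj, hNt, Rat.cast_mul, Rat.cast_intCast,
    mul_div_cancel_right₀ _ (Rat.cast_ne_zero.2 (absNorm_unit_pos 𝔞).ne')]

include hNt in
theorem gram_neighborPseudoBasis_zero_zero :
    (h.neighborPseudoBasis 𝔭 𝔞 t k).gram 0 0 = k + 1 + m := by
  rw [h.gram_rowPseudoBasis, neighborMatrix_row_zero, diagSpace_form, Fin.sum_univ_castSucc,
    ← h.mul_conj_div_absNorm 𝔞 hNt]
  simp [Fin.castSucc_ne_last, div_eq_inv_mul, mul_assoc]

include hNt in
theorem gram_neighborPseudoBasis_zero_of_ne {j : Fin (k + 2)} (h0 : j ≠ 0) (hl : j ≠ Fin.last _) :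
    (h.neighborPseudoBasis 𝔭 𝔞 t k).gram 0 j = 1 - m := by
  rw [h.gram_neighborPseudoBasis_of_ne 𝔭 𝔞 t 0 h0 hl, neighborMatrix_row_zero,
    Function.update_self, Function.update_of_ne hl, Pi.one_apply, h.mul_conj_div_absNorm 𝔞 hNt]

include hNt in
theorem gram_neighborPseudoBasis_of_ne_of_ne {i j : Fin (k + 2)} (hi0 : i ≠ 0)
    (hil : i ≠ Fin.last _) (hj0 : j ≠ 0) (hjl : j ≠ Fin.last _) :
    (h.neighborPseudoBasis 𝔭 𝔞 t k).gram i j = (1 : Matrix _ _ ℤ) i j + m := by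
  rw [h.gram_neighborPseudoBasis_of_ne 𝔭 𝔞 t i hj0 hjl, neighborMatrix_row_of_ne hi0 hil,
    ← h.mul_conj_div_absNorm 𝔞 hNt]
  obtain rfl | hij := eq_or_ne i j <;> simp [*, neg_div, Ne.symm]

end IsImaginaryQuadratic

namespace IsImaginaryQuadratic

variable {K : Type u} [Field K] [NumberField K] {D : ℤ} {δ : K} {σ : K ≃ₐ[ℚ] K} {k : ℕ}
  (h : IsImaginaryQuadratic D δ σ) {𝔭 𝔞 : (FractionalIdeal (𝓞 K)⁰ K)ˣ} {t : K} {m : ℤ}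

theorem neighborPseudoBasis_ideal :
    (h.neighborPseudoBasis 𝔭 𝔞 t k).ideal = neighborIdeal k 𝔭 𝔞 := rfl

section Parity

variable (hP : FractionalIdeal.absNorm (𝔭 : FractionalIdeal (𝓞 K)⁰ K) = 2)

include hP in
theorem absNorm_mul_gram_neighborPseudoBasis_last (i : Fin (k + 2)) :
    (FractionalIdeal.absNorm ((h.neighborPseudoBasis 𝔭 𝔞 t k).ideal (Fin.last _) :
      FractionalIdeal (𝓞 K)⁰ K) : K) *
      (h.neighborPseudoBasis 𝔭 𝔞 t k).gram i (Fin.last _) =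
        2 * (neighborMatrix k t).row i (Fin.last _) := by
  have hN : (FractionalIdeal.absNorm (𝔞 : FractionalIdeal (𝓞 K)⁰ K) : K) ≠ 0 :=
    Rat.cast_ne_zero.2 (absNorm_unit_pos 𝔞).ne'
  rw [h.gram_neighborPseudoBasis_last, neighborPseudoBasis_ideal, neighborIdeal_last, Units.val_mul,
    map_mul, hP, Rat.cast_mul, Rat.cast_ofNat, mul_assoc, mul_div_cancel₀ _ hN]

include hP in
theorem absNorm_mul_gram_neighborPseudoBasis_zero_zero
    (hNt : Algebra.norm ℚ t = m * FractionalIdeal.absNorm (𝔞 : FractionalIdeal (𝓞 K)⁰ K))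
    {q : ℤ} (hq : k + 1 + m = 4 * q) :
    (FractionalIdeal.absNorm ((h.neighborPseudoBasis 𝔭 𝔞 t k).ideal 0 :
      FractionalIdeal (𝓞 K)⁰ K) : K) *
      (h.neighborPseudoBasis 𝔭 𝔞 t k).gram 0 0 = (2 * q : ℤ) := by
  have hqK : (k + 1 + m : K) = 4 * q := by exact_mod_cast congrArg (Int.cast (R := K)) hq
  rw [h.gram_neighborPseudoBasis_zero_zero 𝔭 𝔞 hNt, neighborPseudoBasis_ideal, neighborIdeal_zero,
    Units.val_inv_eq_inv_val, map_inv₀, hP, hqK]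
  push_cast
  ring

variable (hm : Odd m)
  (hNt : Algebra.norm ℚ t = m * FractionalIdeal.absNorm (𝔞 : FractionalIdeal (𝓞 K)⁰ K))
  (hmod : 4 ∣ k + 1 + m)

include hP hm hNt hmod in
theorem scale_neighborLattice_le_one (ht : t ∈ (𝔞 : FractionalIdeal (𝓞 K)⁰ K))
    (htwo : (2 : K) ∈ (𝔭 : FractionalIdeal (𝓞 K)⁰ K))
    (htwo' : (2 : K) ∈ ((𝔭 * 𝔭 : (FractionalIdeal (𝓞 K)⁰ K)ˣ) : FractionalIdeal (𝓞 K)⁰ K)) :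
    (h.neighborLattice 𝔭 𝔞 t k).scale ≤ 1 := by
  have hint (a : ℤ) : (a : K) ∈ (1 : FractionalIdeal (𝓞 K)⁰ K) :=
    FractionalIdeal.mem_one_iff _ |>.2 ⟨a, map_intCast _ a⟩
  refine (h.neighborPseudoBasis 𝔭 𝔞 t k).scale_le_one h fun i j hij => ?_
  obtain rfl | hj0 := eq_or_ne j 0
  · obtain rfl : i = 0 := Fin.le_zero_iff.1 hij
    obtain ⟨q, hq⟩ := hmod
    rw [h.absNorm_mul_gram_neighborPseudoBasis_zero_zero hP hNt hq, inv_mul_cancel]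
    exact hint _
  obtain rfl | hjl := eq_or_ne j (Fin.last _)
  · rw [h.absNorm_mul_gram_neighborPseudoBasis_last hP i, neighborPseudoBasis_ideal]
    obtain rfl | hi0 := eq_or_ne i 0
    · rw [neighborMatrix_row_zero, Function.update_self, neighborIdeal_zero, neighborIdeal_last,
        inv_inv, ← mul_assoc, Units.val_mul]
      exact FractionalIdeal.mul_mem_mul htwo' ht
    obtain rfl | hil := eq_or_ne i (Fin.last _)
    · rw [neighborMatrix_row_last, Pi.single_eq_same, inv_mul_cancel]
      exact_mod_cast hint (2 * 1)
    · rw [neighborMatrix_row_of_ne hi0 hil, neighborIdeal_of_ne hi0 hil, neighborIdeal_last,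
        inv_one, one_mul, Units.val_mul, Pi.sub_apply, Pi.single_eq_of_ne' hil, zero_sub,
        Pi.single_eq_same]
      exact FractionalIdeal.mul_mem_mul htwo (Submodule.neg_mem _ ht)
  rw [neighborPseudoBasis_ideal, neighborIdeal_of_ne hj0 hjl, Units.val_one, map_one, Rat.cast_one,
    one_mul, mul_one]
  have hil : i ≠ Fin.last _ := (hij.trans_lt (Fin.lt_last_iff_ne_last.2 hjl)).ne
  obtain rfl | hi0 := eq_or_ne i 0
  · obtain ⟨c, rfl⟩ := hm
    have hc : (1 - (2 * c + 1 : ℤ) : K) = (-c : ℤ) * 2 := by push_cast; ring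
    rw [h.gram_neighborPseudoBasis_zero_of_ne 𝔭 𝔞 hNt hj0 hjl, neighborIdeal_zero, inv_inv, hc,
      ← one_mul (𝔭 : FractionalIdeal (𝓞 K)⁰ K)]
    exact FractionalIdeal.mul_mem_mul (hint _) htwo
  · rw [h.gram_neighborPseudoBasis_of_ne_of_ne 𝔭 𝔞 hNt hi0 hil hj0 hjl, neighborIdeal_of_ne hi0 hil,
      inv_one]
    exact_mod_cast hint _

include hP hm hNt hmod in
theorem isEven_neighborLattice (hD : ¬ D ≡ 1 [ZMOD 4])
    (hscale : (h.neighborLattice 𝔭 𝔞 t k).scale ≤ 1) :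
    (h.neighborLattice 𝔭 𝔞 t k).IsEven := by
  have heven {a : ℤ} (ha : Even a) : (a : K) ∈ Submodule.span (𝓞 K) {(2 : K)} := by
    obtain ⟨c, rfl⟩ := ha.two_dvd
    exact Submodule.mem_span_singleton.2 ⟨c, by simp [Algebra.smul_def, mul_comm]⟩
  refine (h.neighborPseudoBasis 𝔭 𝔞 t k).isEven h hD hscale fun i => ?_
  obtain rfl | h0 := eq_or_ne i 0
  · obtain ⟨q, hq⟩ := hmod
    rw [h.absNorm_mul_gram_neighborPseudoBasis_zero_zero hP hNt hq]
    exact heven (even_two_mul q)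
  obtain rfl | hl := eq_or_ne i (Fin.last _)
  · rw [h.absNorm_mul_gram_neighborPseudoBasis_last hP, neighborMatrix_row_last, Pi.single_eq_same,
      mul_one]
    exact Submodule.mem_span_singleton_self _
  · rw [neighborPseudoBasis_ideal, neighborIdeal_of_ne h0 hl, Units.val_one, map_one, Rat.cast_one,
      one_mul, h.gram_neighborPseudoBasis_of_ne_of_ne 𝔭 𝔞 hNt h0 hl h0 hl, Matrix.one_apply_eq]
    exact_mod_cast heven (hm.one_add)

end Parity

theorem isUnimodular_neighborLattice (hscale : (h.neighborLattice 𝔭 𝔞 t k).scale ≤ 1) :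
    (h.neighborLattice 𝔭 𝔞 t k).IsUnimodular := by
  refine h.isUnimodular_rowLattice _ _ _ (Nat.succ_ne_zero _) hscale ?_
  rw [prod_neighborIdeal, Finset.prod_pi_mulSingle', if_pos (Finset.mem_univ _),
    mul_inv_cancel₀ (absNorm_unit_pos 𝔞).ne']

include h

theorem exists_even_unimodular_of_four_dvd (hD : ¬ D ≡ 1 [ZMOD 4])
    (ht : t ∈ (𝔞 : FractionalIdeal (𝓞 K)⁰ K)) (hm : Odd m)
    (hNt : Algebra.norm ℚ t = m * FractionalIdeal.absNorm (𝔞 : FractionalIdeal (𝓞 K)⁰ K))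
    (hmod : 4 ∣ k + 1 + m) : ∃ (V : HermitianSpace K σ) (L : HermitianLattice V),
      L.IsDefinite ∧ L.IsEven ∧ L.IsUnimodular ∧ L.rank = k + 2 ∧
        L.HasSteinitzClass (ClassGroup.mk K 𝔞) := by
  obtain ⟨𝔭, hP, htwo, htwo'⟩ := h.exists_unit_two_mem_mul_self hD
  have hscale := h.scale_neighborLattice_le_one hP hm hNt hmod ht htwo htwo'
  have hpos (i : Fin (k + 2)) : 0 < (Pi.mulSingle (Fin.last (k + 1))
      (FractionalIdeal.absNorm (𝔞 : FractionalIdeal (𝓞 K)⁰ K))⁻¹ : Fin (k + 2) → ℚ) i := by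
    obtain rfl | hi := eq_or_ne i (Fin.last _)
    · rw [Pi.mulSingle_eq_same]
      exact inv_pos.2 (absNorm_unit_pos 𝔞)
    · rw [Pi.mulSingle_eq_of_ne hi]
      exact one_pos
  exact ⟨_, h.neighborLattice 𝔭 𝔞 t k, h.isDefinite_diagSpace hpos _,
    h.isEven_neighborLattice hP hm hNt hmod hD hscale, h.isUnimodular_neighborLattice hscale,
    (h.neighborPseudoBasis 𝔭 𝔞 t k).rank_eq, k + 2, h.neighborPseudoBasis 𝔭 𝔞 t k,
    congrArg _ prod_neighborIdeal⟩

theorem exists_even_unimodular (hD : ¬ D ≡ 1 [ZMOD 4]) (𝔞 : (FractionalIdeal (𝓞 K)⁰ K)ˣ) {n : ℕ}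
    (hn : n ≠ 0) (hev : Even n) (hsymb : D ≡ 3 [ZMOD 4] → normResidueSymbol K 2
      ((FractionalIdeal.absNorm (𝔞 : FractionalIdeal (𝓞 K)⁰ K) : ℚ) : ℚ_[2]) = (-1) ^ (n / 2)) :
    ∃ (V : HermitianSpace K σ) (L : HermitianLattice V),
      L.IsDefinite ∧ L.IsEven ∧ L.IsUnimodular ∧ L.rank = n ∧
        L.HasSteinitzClass (ClassGroup.mk K 𝔞) := by
  obtain ⟨k, rfl⟩ : ∃ k, n = 2 * k + 2 := by
    obtain ⟨l, rfl⟩ := hev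
    exact ⟨l - 1, by omega⟩
  obtain ⟨t, ht, m, hm, hNt⟩ := h.exists_odd_norm 𝔞
  obtain hmod | hmod := em (4 ∣ ((2 * k : ℕ) : ℤ) + 1 + m)
  · exact h.exists_even_unimodular_of_four_dvd hD ht hm hNt hmod
  obtain hD2 | hD3 := h.emod_four hD
  · have hNd : Algebra.norm ℚ (1 + δ) = 1 - D := by simpa using h.norm_add_mul 1 1
    have hδ : 1 + δ ∈ (1 : FractionalIdeal (𝓞 K)⁰ K) := FractionalIdeal.mem_one_iff _ |>.2
      ⟨⟨1 + δ, isIntegral_one.add h.isIntegral_sqrt⟩, rfl⟩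
    have hodd : Odd (1 - D) := Int.odd_iff.2 (by omega)
    refine h.exists_even_unimodular_of_four_dvd hD (t := (1 + δ) * t) (m := (1 - D) * m)
      (one_mul (𝔞 : FractionalIdeal (𝓞 K)⁰ K) ▸ FractionalIdeal.mul_mem_mul hδ ht)
      (hodd.mul hm) ?_ ?_
    · rw [map_mul, hNd, hNt]
      push_cast
      ring
    · obtain ⟨j, rfl⟩ : ∃ j, D = 4 * j + 2 := ⟨D / 4, by omega⟩
      obtain ⟨c, rfl⟩ := hm
      have hexp : (1 - (4 * j + 2)) * (2 * c + 1) = -(2 * c + 1) - 4 * (j * (2 * c + 1)) := by ring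
      omega
  · have hN := (absNorm_unit_pos 𝔞).ne'
    have hmk := (h.normResidueSymbol_two_eq_neg_one_pow_iff hD3 hm hN hNt _).1 (hsymb hD3)
    rw [show (2 * k + 2) / 2 = k + 1 by omega, Int.ModEq] at hmk
    obtain hk | hk := Nat.even_or_odd k
    · rw [hk.add_one.neg_one_pow] at hmk
      obtain ⟨l, rfl⟩ := hk
      omega
    · rw [hk.add_one.neg_one_pow] at hmk
      obtain ⟨l, rfl⟩ := hk
      omega

end IsImaginaryQuadratic

/-- `K = ℚ(√D)` with `D < 0` square-free, and `σ` is its nontrivial automorphism. -/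
theorem theorem2 {K : Type u} [Field K] [NumberField K] (D : ℤ) (hD : D < 0) (hsq : Squarefree D)
    (δ : K) (hδ : δ ^ 2 = (D : K)) (hK : IntermediateField.adjoin ℚ {δ} = ⊤)
    (σ : K ≃ₐ[ℚ] K) (hσ : σ ≠ AlgEquiv.refl)
    (𝔞 : (FractionalIdeal (𝓞 K)⁰ K)ˣ) (n : ℕ) (hn : 1 ≤ n) :
    (∃ (V : HermitianSpace K σ) (L : HermitianLattice V),
      L.IsDefinite ∧ L.IsOdd ∧ L.IsUnimodular ∧ L.rank = n ∧
        L.HasSteinitzClass (ClassGroup.mk K 𝔞)) ∧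
    ((∃ (V : HermitianSpace K σ) (L : HermitianLattice V),
      L.IsDefinite ∧ L.IsEven ∧ L.IsUnimodular ∧ L.rank = n ∧
        L.HasSteinitzClass (ClassGroup.mk K 𝔞)) ↔
      Even (NumberField.discr K) ∧ Even n ∧
        (D ≡ 3 [ZMOD 4] →
          normResidueSymbol K 2
            ((FractionalIdeal.absNorm (𝔞 : FractionalIdeal (𝓞 K)⁰ K) : ℚ) : ℚ_[2]) =
              (-1) ^ (n / 2))) := by
  have h := IsImaginaryQuadratic.of_adjoin hD hsq hδ hK hσ
  have hn0 : n ≠ 0 := Nat.one_le_iff_ne_zero.1 hn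
  refine ⟨h.exists_odd_unimodular 𝔞 hn0, ?_, ?_⟩
  · rintro ⟨V, L, hdef, hev, huni, rfl, hst⟩
    exact ⟨h.even_discr_iff.2 (hev.not_modEq_one h huni.2.1),
      hev.even_and_normResidueSymbol_eq h hdef huni hst⟩
  · rintro ⟨hdisc, hne, hsymb⟩
    exact h.exists_even_unimodular (h.even_discr_iff.1 hdisc) 𝔞 hn0 hne hsymb
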